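/- **Theorem (Equivalent conditions).** Let $f=h+\overline g$ be a sense-preserving harmonic mapping of the unit disk $\mathbb D$, i.e. $h,g$ are analytic in $\mathbb D$ and $|h'|^2-|g'|^2>0$ there. *Notation.* For $a\in\mathbb D$ and $0<\rho\le\infty$ let $D_h(a,\rho)=\{z\in\mathbb D: 2\tanh^{-1}|\frac{z-a}{1-\overline a z}|<\rho\}$. A function $F$ on $\mathbb D$ is ULU (resp. ULC) if $$\inf_{z\in\mathbb D}\ \sup\{\rho\in(0,\infty]: F\text{ is univalent (resp. convex) in }D_h(z,\rho)\}>0,$$ where $\sup\emptyset=0$, and convex in a set means univalent with convex image of that set. For a sense-preserving harmonic $F=H+\overline G$ with dilatation $\omega=G'/H'$ put $$P_F=\frac{H''\overline{H'}-G''\overline{G'}}{|H'|^2-|G'|^2},\qquad S_F=S_H+\frac{\overline\omega}{1-|\omega|^2}\Big(\frac{H''}{H'}\omega'-\omega''\Big)-\frac32\Big(\frac{\overline\omega\,\omega'}{1-|\omega|^2}\Big)^2,$$ with $S_H=\frac{H'''}{H'}-\frac32\big(\frac{H''}{H'}\big)^2$, and $\|P_F\|=\sup_{z\in\mathbb D}(1-|z|^2)|P_F(z)|$,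 $\|S_F\|=\sup_{z\in\mathbb D}(1-|z|^2)^2|S_F(z)|$; analytic functions are the case $G=0$. For an analytic function $\varphi$ on $\mathbb D$ let $(\ast)$ be the condition: there are a constant $m>0$ and a univalent analytic function $F$ in $\mathbb D$ with $\varphi'=(F')^m$, for some analytic branch $(F')^m=\exp(m\log F')$. Call a property of $\varepsilon\in\overline{\mathbb D}$ *stable* if for any two distinct $\varepsilon_1,\varepsilon_2\in\overline{\mathbb D}$ it holds for $\varepsilon_1$ if and only if it holds for $\varepsilon_2$. *(a)* The following nine conditions are equivalent. 1. ($h+g$ is SAULU) The property "$h+\varepsilon g$ is ULU" is stable. 2. ($h+g$ is SAULC) The property "$h+\varepsilon g$ is ULC" is stable. 3. ($h+g$ has SBAPSN) The property "$\|P_{h+\varepsilon g}\|<\infty$" is stable. 4. ($h+g$ has SBASN) The property "$\|S_{h+\varepsilon g}\|<\infty$" is stable. 5. The property "$h+\varepsilon g$ satisfies $(\ast)$" is stable. 6. ($f$ is SHULU) The property "$h+\varepsilon\overline g$ is ULU" is stable. 7. ($f$ is SHULC) The property "$h+\varepsilon\overline g$ is ULC" is stable. 8. ($f$ has SBHPSN)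 The property "$\|P_{h+\varepsilon\overline g}\|<\infty$" is stable. 9. ($f$ has SBHSN) The property "$\|S_{h+\varepsilon\overline g}\|<\infty$" is stable. *(b)* Moreover, for all $\varepsilon_1,\varepsilon_2\in\overline{\mathbb D}$ the following properties are equivalent: $h+\varepsilon_1g$ is ULU; $h+\varepsilon_1g$ is ULC; $\|P_{h+\varepsilon_1g}\|<\infty$; $\|S_{h+\varepsilon_1g}\|<\infty$; $h+\varepsilon_1g$ satisfies $(\ast)$; $h+\varepsilon_2\overline g$ is ULU; $h+\varepsilon_2\overline g$ is ULC; $\|P_{h+\varepsilon_2\overline g}\|<\infty$; $\|S_{h+\varepsilon_2\overline g}\|<\infty$. *(c)* In particular, $f$ is ULU if and only if $f$ is ULC, if and only if $\|P_f\|<\infty$, if and only if $\|S_f\|<\infty$. -/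

import Mathlib

open scoped ENNReal ComplexConjugate

noncomputable section

namespace HarmonicULU

/-- The open unit disk of `ℂ`. -/
def unitDisk : Set ℂ := Metric.ball 0 1

/-- The harmonic mapping `h + conj g` with analytic part `h` and co-analytic part `g`. -/
def harm (h g : ℂ → ℂ) : ℂ → ℂ := fun z => h z + conj (g z)

/-- `h + conj g` is a sense-preserving harmonic mapping of the unit disk: `h`, `g` are analytic
there and the Jacobian `|h'|² - |g'|²` is positive. -/
structure IsSensePreservingHarmonic (h g : ℂ → ℂ) : Prop where
  analytic_h : DifferentiableOn ℂ h unitDisk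
  analytic_g : DifferentiableOn ℂ g unitDisk
  jacobian_pos : ∀ z ∈ unitDisk, 0 < ‖deriv h z‖ ^ 2 - ‖deriv g z‖ ^ 2

/-- The hyperbolic distance `2 artanh |(z - a) / (1 - conj a * z)|` of the unit disk. -/
def hypDist (z a : ℂ) : ℝ := 2 * Real.artanh ‖(z - a) / (1 - conj a * z)‖

/-- The hyperbolic disk with center `a` and hyperbolic radius `ρ ∈ (0, ∞]`. -/
def hypDisk (a : ℂ) (ρ : ℝ≥0∞) : Set ℂ :=
  {z | z ∈ unitDisk ∧ ENNReal.ofReal (hypDist z a) < ρ}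

/-- `f` is univalent in `s`. -/
def UnivalentIn (f : ℂ → ℂ) (s : Set ℂ) : Prop := Set.InjOn f s

/-- `f` is convex in `s`: it is univalent there, and the image of `s` is a convex set. -/
def ConvexIn (f : ℂ → ℂ) (s : Set ℂ) : Prop := Set.InjOn f s ∧ Convex ℝ (f '' s)

/-- The uniformly hyperbolic radius `ρ(f) ∈ [0, ∞]`. -/
def hypRadius (f : ℂ → ℂ) : ℝ≥0∞ :=
  ⨅ z ∈ unitDisk, sSup {ρ : ℝ≥0∞ | 0 < ρ ∧ UnivalentIn f (hypDisk z ρ)}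

/-- The analogous radius `ρ*(f) ∈ [0, ∞]` for convexity. -/
def hypConvexRadius (f : ℂ → ℂ) : ℝ≥0∞ :=
  ⨅ z ∈ unitDisk, sSup {ρ : ℝ≥0∞ | 0 < ρ ∧ ConvexIn f (hypDisk z ρ)}

/-- Uniformly locally univalent. -/
def ULU (f : ℂ → ℂ) : Prop := 0 < hypRadius f

/-- Uniformly locally convex. -/
def ULC (f : ℂ → ℂ) : Prop := 0 < hypConvexRadius f

/-- The dilatation `g' / h'` of `h + conj g`. -/
def dilatation (h g : ℂ → ℂ) : ℂ → ℂ := fun z => deriv g z / deriv h z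

/-- The pre-Schwarzian derivative of `h + conj g`. -/
def preSchwarzian (h g : ℂ → ℂ) (z : ℂ) : ℂ :=
  (deriv (deriv h) z * conj (deriv h z) - deriv (deriv g) z * conj (deriv g z)) /
    ((‖deriv h z‖ ^ 2 - ‖deriv g z‖ ^ 2 : ℝ) : ℂ)

/-- The classical Schwarzian derivative of a locally univalent analytic function. -/
def analyticSchwarzian (h : ℂ → ℂ) (z : ℂ) : ℂ :=
  deriv (deriv (deriv h)) z / deriv h z - 3 / 2 * (deriv (deriv h) z / deriv h z) ^ 2

/-- The Schwarzian derivative of `h + conj g`; below `ω` is the dilatation. -/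
def schwarzian (h g : ℂ → ℂ) (z : ℂ) : ℂ :=
  let ω := dilatation h g
  analyticSchwarzian h z
    + conj (ω z) / ((1 - ‖ω z‖ ^ 2 : ℝ) : ℂ) *
        (deriv (deriv h) z / deriv h z * deriv ω z - deriv (deriv ω) z)
    - 3 / 2 * (conj (ω z) * deriv ω z / ((1 - ‖ω z‖ ^ 2 : ℝ) : ℂ)) ^ 2

/-- The pre-Schwarzian norm of `h + conj g`, as an element of `[0, ∞]`. -/
def preSchwarzianNorm (h g : ℂ → ℂ) : ℝ≥0∞ :=
  ⨆ z ∈ unitDisk, ENNReal.ofReal ((1 - ‖z‖ ^ 2) * ‖preSchwarzian h g z‖)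

/-- The Schwarzian norm of `h + conj g`, as an element of `[0, ∞]`. -/
def schwarzianNorm (h g : ℂ → ℂ) : ℝ≥0∞ :=
  ⨆ z ∈ unitDisk, ENNReal.ofReal ((1 - ‖z‖ ^ 2) ^ 2 * ‖schwarzian h g z‖)

/-- The pre-Schwarzian norm is finite. -/
def BoundedPSN (h g : ℂ → ℂ) : Prop := preSchwarzianNorm h g < ⊤

/-- The Schwarzian norm is finite. -/
def BoundedSN (h g : ℂ → ℂ) : Prop := schwarzianNorm h g < ⊤

/-- `φ' = (F')^m` for some constant `m > 0` and some univalent analytic `F` on the unit disk. The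
power is `exp (m * L)` for an analytic branch `L` of `log F'`. -/
def IsPowerOfUnivalent (φ : ℂ → ℂ) : Prop :=
  ∃ (m : ℝ) (F L : ℂ → ℂ), 0 < m ∧ DifferentiableOn ℂ F unitDisk ∧ UnivalentIn F unitDisk ∧
    DifferentiableOn ℂ L unitDisk ∧ (∀ z ∈ unitDisk, Complex.exp (L z) = deriv F z) ∧
    ∀ z ∈ unitDisk, deriv φ z = Complex.exp ((m : ℂ) * L z)

/-- The analytic function `h + ε g`. -/
def anaPerturb (h g : ℂ → ℂ) (ε : ℂ) : ℂ → ℂ := fun z => h z + ε * g z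

/-- The co-analytic part of `h + ε * conj g`, namely `conj ε * g`. -/
def coPart (g : ℂ → ℂ) (ε : ℂ) : ℂ → ℂ := fun z => conj ε * g z

/-- The harmonic mapping `h + ε * conj g`. -/
def harmPerturb (h g : ℂ → ℂ) (ε : ℂ) : ℂ → ℂ := harm h (coPart g ε)

/-- A property of a parameter in the closed unit disk is stable if it holds at one of any two
distinct parameters exactly when it holds at the other. -/
def Stable (p : ℂ → Prop) : Prop :=
  ∀ ε₁ ε₂ : ℂ, ‖ε₁‖ ≤ 1 → ‖ε₂‖ ≤ 1 → ε₁ ≠ ε₂ → (p ε₁ ↔ p ε₂)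

/-- `h + g` is stable analytic uniformly locally univalent. -/
def SAULU (h g : ℂ → ℂ) : Prop := Stable fun ε => ULU (anaPerturb h g ε)

/-- `h + g` is stable analytic uniformly locally convex. -/
def SAULC (h g : ℂ → ℂ) : Prop := Stable fun ε => ULC (anaPerturb h g ε)

/-- `h + g` has stable bounded analytic pre-Schwarzian norm. An analytic function is a harmonic
mapping with zero co-analytic part. -/
def SBAPSN (h g : ℂ → ℂ) : Prop := Stable fun ε => BoundedPSN (anaPerturb h g ε) 0

/-- `h + g` has stable bounded analytic Schwarzian norm. -/
def SBASN (h g : ℂ → ℂ) : Prop := Stable fun ε => BoundedSN (anaPerturb h g ε) 0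

/-- Stability of the representation `(h + ε g)' = (F')^m`. -/
def StablePower (h g : ℂ → ℂ) : Prop := Stable fun ε => IsPowerOfUnivalent (anaPerturb h g ε)

/-- `h + conj g` is stable harmonic uniformly locally univalent. -/
def SHULU (h g : ℂ → ℂ) : Prop := Stable fun ε => ULU (harmPerturb h g ε)

/-- `h + conj g` is stable harmonic uniformly locally convex. -/
def SHULC (h g : ℂ → ℂ) : Prop := Stable fun ε => ULC (harmPerturb h g ε)

/-- `h + conj g` has stable bounded harmonic pre-Schwarzian norm. -/
def SBHPSN (h g : ℂ → ℂ) : Prop := Stable fun ε => BoundedPSN h (coPart g ε)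

/-- `h + conj g` has stable bounded harmonic Schwarzian norm. -/
def SBHSN (h g : ℂ → ℂ) : Prop := Stable fun ε => BoundedSN h (coPart g ε)

end HarmonicULU

end

namespace HarmonicULU

open Metric Set

/-! Every property in the theorem, at every parameter, is equivalent to one condition free of `ε`:
the pre-Schwarzian `p = h'' / h'` is `O(1 / (1 - |z|²))`, that is, `PreBdd h`. So each stability
condition simply holds, and (b) and (c) follow by passing through `PreBdd h`.

For one sense-preserving `f = h + conj g` with dilatation `ω`, Schwarz–Pick bounds for `ω'` and
`ω''` make `P_f - p` bounded in hyperbolic norm, and `S_f - S_h` bounded up to a multiple of `p`.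
Since `S_h = p' - p² / 2`, a bound on `p` bounds `S_f` by Cauchy's estimate; conversely a bound on
`S_f` is a Riccati inequality whose pole-free solutions are bounded (`exists_riccati_bound`).

If `p` is bounded, an affine change of the target makes `f` nearly the identity on small disks,
whose images are then convex (`convexIn_harm_ball`, `ulc_of_preBdd`). If `p` is unbounded, rescaling
at well-chosen points makes `f` look like `exp` on a disk containing `0` and `2πi`, which destroys
injectivity (`not_injOn_of_large_pre`, `preBdd_of_ulu`).

The perturbation `h + ε g` changes `p` by a hyperbolically bounded amount. Condition `(∗)` is
matched by a Becker-type criterion: for large `m`, the function with derivative `(φ')^(1/m)` is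
univalent. -/

lemma mem_unitDisk {z : ℂ} : z ∈ unitDisk ↔ ‖z‖ < 1 := by simp [unitDisk]

lemma isOpen_unitDisk : IsOpen unitDisk := isOpen_ball

lemma ball_subset_unitDisk {c : ℂ} {d : ℝ} (hd : d ≤ 1 - ‖c‖) : ball c d ⊆ unitDisk :=
  ball_subset_ball' (by simpa [dist_zero_right] using by linarith)

lemma le_one_sub_sq {z : ℂ} (hz : z ∈ unitDisk) : 1 - ‖z‖ ≤ 1 - ‖z‖ ^ 2 := by
  nlinarith [norm_nonneg z, mem_unitDisk.1 hz]

lemma one_sub_sq_le (z : ℂ) : 1 - ‖z‖ ^ 2 ≤ 2 * (1 - ‖z‖) := by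
  nlinarith [sq_nonneg (1 - ‖z‖)]

lemma one_sub_norm_pos {z : ℂ} (hz : z ∈ unitDisk) : 0 < 1 - ‖z‖ := by
  linarith [mem_unitDisk.1 hz]

lemma iSup_ofReal_lt_top_iff (f : ℂ → ℝ) :
    (⨆ z ∈ unitDisk, ENNReal.ofReal (f z)) < ⊤ ↔ ∃ C, ∀ z ∈ unitDisk, f z ≤ C := by
  constructor
  · intro h
    refine ⟨(⨆ z ∈ unitDisk, ENNReal.ofReal (f z)).toReal, fun z hz => ?_⟩
    refine (ENNReal.ofReal_le_iff_le_toReal h.ne).1 ?_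
    exact le_iSup₂ (f := fun z (_ : z ∈ unitDisk) => ENNReal.ofReal (f z)) z hz
  · rintro ⟨C, hC⟩
    exact (iSup₂_le fun z hz => ENNReal.ofReal_le_ofReal (hC z hz)).trans_lt ENNReal.ofReal_lt_top

/-- The pre-Schwarzian `φ'' / φ'` of an analytic function has finite hyperbolic sup norm. -/
def PreBdd (φ : ℂ → ℂ) : Prop :=
  ∃ C : ℝ, ∀ z ∈ unitDisk, (1 - ‖z‖ ^ 2) * ‖deriv (deriv φ) z / deriv φ z‖ ≤ C

/-- A nonvanishing holomorphic function on a disk is an exponential there. -/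
lemma exists_log {u : ℂ → ℂ} {c : ℂ} {R : ℝ} (hR : 0 < R) (hu : DifferentiableOn ℂ u (ball c R))
    (h0 : ∀ z ∈ ball c R, u z ≠ 0) :
    ∃ L : ℂ → ℂ, L c = 0 ∧ (∀ z ∈ ball c R, HasDerivAt L (deriv u z / u z) z) ∧
      ∀ z ∈ ball c R, u z = u c * Complex.exp (L z) := by
  obtain ⟨L, hL, hLd⟩ :=
    (((hu.deriv isOpen_ball).fun_div hu h0).isExactOn_ball).with_val_at c 0
  refine ⟨L, hL, hLd, fun z hz => ?_⟩
  have hconst : ∀ w ∈ ball c R, HasDerivAt (fun z => u z * Complex.exp (-L z)) 0 w := by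
    intro w hw
    have h1 := ((hu.differentiableAt (isOpen_ball.mem_nhds hw)).hasDerivAt).mul
      ((hLd w hw).neg.cexp)
    refine h1.congr_deriv ?_
    have := h0 w hw
    field_simp; ring
  have := (convex_ball c R).is_const_of_fderivWithin_eq_zero (𝕜 := ℂ)
    (f := fun z => u z * Complex.exp (-L z))
    (fun w hw => (hconst w hw).differentiableAt.differentiableWithinAt)
    (fun w hw => by
      rw [fderivWithin_of_isOpen isOpen_ball hw]
      simpa using (hconst w hw).hasFDerivAt.fderiv) hz (mem_ball_self hR)
  simp only [hL, neg_zero, Complex.exp_zero, mul_one] at this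
  rw [← this, mul_assoc, ← Complex.exp_add]; simp

lemma norm_sub_le_of_hasDerivAt {f f' : ℂ → ℂ} {s : Set ℂ} {C : ℝ} (hs : Convex ℝ s)
    (hf : ∀ z ∈ s, HasDerivAt f (f' z) z) (hC : ∀ z ∈ s, ‖f' z‖ ≤ C) {x y : ℂ} (hx : x ∈ s)
    (hy : y ∈ s) : ‖f y - f x‖ ≤ C * ‖y - x‖ :=
  hs.norm_image_sub_le_of_norm_hasDerivWithin_le (fun z hz => (hf z hz).hasDerivWithinAt) hC hx hy

/-! ### Schwarz–Pick estimates for self-maps of the disk. -/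

lemma one_sub_mobius_sq (a w : ℂ) :
    ‖1 - conj a * w‖ ^ 2 - ‖w - a‖ ^ 2 = (1 - ‖a‖ ^ 2) * (1 - ‖w‖ ^ 2) := by
  simp only [← Complex.normSq_eq_norm_sq, Complex.normSq_apply]
  simp
  ring

lemma one_sub_conj_mul_ne_zero {a w : ℂ} (ha : ‖a‖ < 1) (hw : ‖w‖ < 1) : 1 - conj a * w ≠ 0 := by
  intro h
  have h1 : ‖conj a * w‖ < 1 := by
    rw [norm_mul, Complex.norm_conj]
    nlinarith [norm_nonneg a, norm_nonneg w]
  rw [← sub_eq_zero.1 h] at h1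
  simp at h1

lemma norm_mobius_lt_one {a w : ℂ} (ha : ‖a‖ < 1) (hw : ‖w‖ < 1) :
    ‖(w - a) / (1 - conj a * w)‖ < 1 := by
  have h0 := norm_pos_iff.2 (one_sub_conj_mul_ne_zero ha hw)
  rw [norm_div, div_lt_one h0]
  have := one_sub_mobius_sq a w
  have h1 : 0 < (1 - ‖a‖ ^ 2) * (1 - ‖w‖ ^ 2) := by
    apply mul_pos <;> nlinarith [norm_nonneg a, norm_nonneg w]
  exact lt_of_pow_lt_pow_left₀ 2 h0.le (by linarith)

lemma differentiableOn_mobius {ω : ℂ → ℂ} (hω : DifferentiableOn ℂ ω unitDisk)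
    (hmap : ∀ z ∈ unitDisk, ‖ω z‖ < 1)
    {c : ℂ} (hc : c ∈ unitDisk) :
    DifferentiableOn ℂ (fun z => (ω z - ω c) / (1 - conj (ω c) * ω z)) unitDisk :=
  (hω.sub_const _).fun_div ((hω.const_mul _).const_sub _)
    fun z hz => one_sub_conj_mul_ne_zero (hmap c hc) (hmap z hz)

/-- The Schwarz lemma on a Euclidean ball about `c`, after moving `ω c` to `0` by a disk
automorphism of the target. Leaving the source disk alone only costs a constant. -/
lemma norm_mobius_le {ω : ℂ → ℂ} (hω : DifferentiableOn ℂ ω unitDisk)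
    (hmap : ∀ z ∈ unitDisk, ‖ω z‖ < 1)
    {c z : ℂ} {d : ℝ} (hc : c ∈ unitDisk) (hd : d ≤ 1 - ‖c‖) (hz : z ∈ ball c d) :
    ‖(ω z - ω c) / (1 - conj (ω c) * ω z)‖ ≤ ‖z - c‖ / d := by
  have hs := ball_subset_unitDisk hd
  have := Complex.dist_le_div_mul_dist_of_mapsTo_ball (R₂ := 1)
    ((differentiableOn_mobius hω hmap hc).mono hs)
    (fun w hw => by
      simpa using (norm_mobius_lt_one (hmap c hc) (hmap w (hs hw))).le) hz
  simp only [sub_self, zero_div, dist_zero_right] at this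
  rw [dist_eq_norm] at this
  calc _ ≤ _ := this
    _ = _ := by ring

lemma hasDerivAt_mobius {ω : ℂ → ℂ} (hω : DifferentiableOn ℂ ω unitDisk)
    (hmap : ∀ z ∈ unitDisk, ‖ω z‖ < 1)
    {c z : ℂ} (hc : c ∈ unitDisk) (hz : z ∈ unitDisk) :
    HasDerivAt (fun z => (ω z - ω c) / (1 - conj (ω c) * ω z))
      (deriv ω z * (1 - ‖ω c‖ ^ 2 : ℝ) / (1 - conj (ω c) * ω z) ^ 2) z := by
  have h1 := (hω.differentiableAt (isOpen_unitDisk.mem_nhds hz)).hasDerivAt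
  have h2 := (h1.sub_const (ω c)).fun_div ((h1.const_mul (conj (ω c))).const_sub 1)
    (one_sub_conj_mul_ne_zero (hmap c hc) (hmap z hz))
  refine h2.congr_deriv ?_
  have : ((‖ω c‖ ^ 2 : ℝ) : ℂ) = conj (ω c) * ω c := by
    rw [← Complex.normSq_eq_norm_sq, mul_comm, Complex.mul_conj]
  push_cast at this ⊢
  rw [this]; ring

lemma one_sub_sq_pos {ω : ℂ → ℂ} (hmap : ∀ z ∈ unitDisk, ‖ω z‖ < 1)
    {c : ℂ} (hc : c ∈ unitDisk) : 0 < 1 - ‖ω c‖ ^ 2 := by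
  nlinarith [hmap c hc, norm_nonneg (ω c)]

lemma one_sub_conj_mul_self (a : ℂ) : 1 - conj a * a = ((1 - ‖a‖ ^ 2 : ℝ) : ℂ) := by
  rw [← Complex.normSq_eq_norm_sq, mul_comm, Complex.mul_conj]; push_cast; rfl

/-- A weak form of the Schwarz–Pick inequality. -/
lemma norm_deriv_le_of_selfMap {ω : ℂ → ℂ} (hω : DifferentiableOn ℂ ω unitDisk)
    (hmap : ∀ z ∈ unitDisk, ‖ω z‖ < 1)
    {c : ℂ} (hc : c ∈ unitDisk) :
    (1 - ‖c‖ ^ 2) * ‖deriv ω c‖ ≤ 2 * (1 - ‖ω c‖ ^ 2) := by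
  have hpos := one_sub_sq_pos hmap hc
  have hc1 := mem_unitDisk.1 hc
  have hs := ball_subset_unitDisk (c := c) le_rfl
  have := Complex.norm_deriv_le_div_of_mapsTo_ball (R₂ := 1) (c := c) (R₁ := 1 - ‖c‖)
    ((differentiableOn_mobius hω hmap hc).mono hs)
    (fun w hw => by
      simpa using (norm_mobius_lt_one (hmap c hc) (hmap w (hs hw))).le) (by linarith)
  rw [(hasDerivAt_mobius hω hmap hc hc).deriv, one_sub_conj_mul_self, norm_div, norm_mul, norm_pow,
    Complex.norm_of_nonneg hpos.le, div_le_div_iff₀ (by positivity) (by linarith)] at this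
  have h3 : ‖deriv ω c‖ * (1 - ‖c‖) ≤ 1 - ‖ω c‖ ^ 2 := by
    nlinarith
  nlinarith [norm_nonneg c, norm_nonneg (deriv ω c)]

lemma one_sub_mul_one_add_mobius {a w : ℂ} (ha : ‖a‖ < 1) (hw : ‖w‖ < 1) :
    (1 - conj a * w) * (1 + conj a * ((w - a) / (1 - conj a * w))) = ((1 - ‖a‖ ^ 2 : ℝ) : ℂ) := by
  have := one_sub_conj_mul_ne_zero ha hw
  rw [← one_sub_conj_mul_self]
  field_simp
  ring

/-- Pseudohyperbolically close points have comparable distance to the circle: the preceding identity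
gives `|1 - conj a * w| ≤ 2(1 - |a|²)`, and `(1 - |a|²)(1 - |w|²) ≤ |1 - conj a * w|²`. -/
lemma one_sub_sq_le_of_norm_mobius_le {a w : ℂ} (ha : ‖a‖ < 1) (hw : ‖w‖ < 1)
    (h : ‖(w - a) / (1 - conj a * w)‖ ≤ 1 / 2) : 1 - ‖w‖ ^ 2 ≤ 4 * (1 - ‖a‖ ^ 2) := by
  have hk : 0 < 1 - ‖a‖ ^ 2 := by nlinarith [norm_nonneg a]
  have h1 := congrArg norm (one_sub_mul_one_add_mobius ha hw)
  rw [norm_mul, Complex.norm_of_nonneg hk.le] at h1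
  have h2 : 1 / 2 ≤ ‖1 + conj a * ((w - a) / (1 - conj a * w))‖ := by
    have h3 : ‖conj a * ((w - a) / (1 - conj a * w))‖ ≤ 1 / 2 := by
      rw [norm_mul, Complex.norm_conj]
      nlinarith [norm_nonneg a, norm_nonneg ((w - a) / (1 - conj a * w))]
    have := norm_sub_norm_le (1 : ℂ) (-(conj a * ((w - a) / (1 - conj a * w))))
    rw [sub_neg_eq_add, norm_neg, norm_one] at this
    linarith
  have h4 : ‖1 - conj a * w‖ ≤ 2 * (1 - ‖a‖ ^ 2) := by
    nlinarith [norm_nonneg (1 - conj a * w)]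
  have h5 := one_sub_mobius_sq a w
  have h6 : (1 - ‖a‖ ^ 2) * (1 - ‖w‖ ^ 2) ≤ (1 - ‖a‖ ^ 2) * (4 * (1 - ‖a‖ ^ 2)) := by
    nlinarith [norm_nonneg (1 - conj a * w), sq_nonneg ‖w - a‖]
  exact le_of_mul_le_mul_left h6 hk

/-- Cauchy's estimate for `ω'` on the circle of radius `d / 2`. There `1 - |ω z|² ≤ 4(1 - |ω c|²)`,
so weak Schwarz–Pick keeps the factor `1 - |ω c|²`, which later cancels the denominators of `P_f`
and `S_f`. -/
lemma norm_deriv_deriv_le_of_selfMap {ω : ℂ → ℂ} (hω : DifferentiableOn ℂ ω unitDisk)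
    (hmap : ∀ z ∈ unitDisk, ‖ω z‖ < 1)
    {c : ℂ} (hc : c ∈ unitDisk) :
    (1 - ‖c‖ ^ 2) ^ 2 * ‖deriv (deriv ω) c‖ ≤ 128 * (1 - ‖ω c‖ ^ 2) := by
  have hpos := one_sub_sq_pos hmap hc
  have hc1 := mem_unitDisk.1 hc
  set d := 1 - ‖c‖ with hd
  have hd0 : 0 < d := by linarith
  have hs := ball_subset_unitDisk (c := c) (d := d) le_rfl
  have hcl : closedBall c (d / 2) ⊆ ball c d := closedBall_subset_ball (by linarith)
  have hdd : DifferentiableOn ℂ (deriv ω) unitDisk := hω.deriv isOpen_unitDisk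
  have key := Complex.norm_deriv_le_of_forall_mem_sphere_norm_le (f := deriv ω) (c := c)
    (R := d / 2) (C := 16 * (1 - ‖ω c‖ ^ 2) / d) (by linarith)
    ((hdd.mono (hcl.trans hs)).diffContOnCl_ball subset_rfl) (by
      intro z hz
      have hz' : z ∈ ball c d := hcl (sphere_subset_closedBall hz)
      have hzD := hs hz'
      have hzn : ‖z - c‖ = d / 2 := by simpa [dist_eq_norm] using hz
      have h1 := norm_deriv_le_of_selfMap hω hmap hzD
      have h2 := one_sub_sq_le_of_norm_mobius_le (hmap c hc) (hmap z hzD) (by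
        refine (norm_mobius_le hω hmap hc le_rfl hz').trans ?_
        rw [hzn, ← hd, div_right_comm, div_self hd0.ne'])
      have h3 : d / 2 ≤ 1 - ‖z‖ := by
        have := norm_sub_norm_le z c
        linarith
      have h4 := le_one_sub_sq hzD
      rw [le_div_iff₀ hd0]
      nlinarith [mul_le_mul_of_nonneg_right (h3.trans h4) (norm_nonneg (deriv ω z))])
  rw [div_div, le_div_iff₀ (by positivity)] at key
  have h4 : (1 - ‖c‖ ^ 2) ^ 2 ≤ 4 * d ^ 2 := by
    have : 1 - ‖c‖ ^ 2 = d * (1 + ‖c‖) := by rw [hd]; ring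
    rw [this, mul_pow]
    have : (1 + ‖c‖) ^ 2 ≤ 4 := by nlinarith [norm_nonneg c]
    nlinarith [sq_nonneg d]
  nlinarith [norm_nonneg (deriv (deriv ω) c), mul_le_mul_of_nonneg_right h4
    (norm_nonneg (deriv (deriv ω) c))]

/-! ### Comparison of hyperbolic norms and the Riccati inequality. -/

lemma exists_bound_iff_of_sub {p q : ℂ → ℂ} {K : ℝ}
    (h : ∀ z ∈ unitDisk, (1 - ‖z‖ ^ 2) * ‖p z - q z‖ ≤ K) :
    (∃ C : ℝ, ∀ z ∈ unitDisk, (1 - ‖z‖ ^ 2) * ‖p z‖ ≤ C) ↔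
      ∃ C : ℝ, ∀ z ∈ unitDisk, (1 - ‖z‖ ^ 2) * ‖q z‖ ≤ C := by
  have aux : ∀ p q : ℂ → ℂ, (∀ z ∈ unitDisk, (1 - ‖z‖ ^ 2) * ‖p z - q z‖ ≤ K) →
      (∃ C : ℝ, ∀ z ∈ unitDisk, (1 - ‖z‖ ^ 2) * ‖p z‖ ≤ C) →
      ∃ C : ℝ, ∀ z ∈ unitDisk, (1 - ‖z‖ ^ 2) * ‖q z‖ ≤ C := by
    rintro p q h ⟨C, hC⟩
    refine ⟨C + K, fun z hz => ?_⟩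
    have h0 : 0 ≤ 1 - ‖z‖ ^ 2 := (one_sub_norm_pos hz).le.trans (le_one_sub_sq hz)
    have h1 : ‖q z‖ ≤ ‖p z‖ + ‖p z - q z‖ := by
      have := norm_sub_le (p z) (p z - q z)
      simpa using this
    nlinarith [h z hz, hC z hz, mul_le_mul_of_nonneg_left h1 h0]
  exact ⟨aux p q h, aux q p fun z hz => by rw [norm_sub_rev]; exact h z hz⟩

/-- A bound at the centre of a disk for solutions `P` of a Riccati type differential inequality
that have no pole in the disk. -/
lemma exists_riccati_bound {K M : ℝ} (hK : 0 ≤ K) (hM : 0 ≤ M) :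
    ∃ C : ℝ, ∀ (c : ℂ) (d : ℝ) (P : ℂ → ℂ), 0 < d → DifferentiableOn ℂ P (ball c d) →
      (∀ z ∈ ball c (d / 2), ‖deriv P z - P z ^ 2 / 2‖ ≤ K / d ^ 2 + M / d * ‖P z‖) →
      d * ‖P c‖ ≤ C := by
  -- On radius `s * d` the right-hand side of the Riccati inequality acts as a small perturbation,
  -- since `s * K` and `s * M` are at most `1 / 16`.
  set s : ℝ := 1 / (16 * (1 + K + M)) with hs
  have hs0 : 0 < s := by positivity
  have hs16 : s * (1 + K + M) = 1 / 16 := by rw [hs]; field_simp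
  have hsK : s * K ≤ 1 / 16 := by nlinarith
  have hsM : s * M ≤ 1 / 16 := by nlinarith
  have hs1 : s ≤ 1 / 16 := by nlinarith
  refine ⟨7 / s, fun c d P hd hP hbound => ?_⟩
  obtain ⟨L, hLc, hL⟩ := (hP.isExactOn_ball).with_val_at c 0
  set ρ := s * d with hρ
  have hρ0 : 0 < ρ := by positivity
  have hsub : closedBall c ρ ⊆ ball c (d / 2) := closedBall_subset_ball (by nlinarith)
  have hsub' : closedBall c ρ ⊆ ball c d := hsub.trans (ball_subset_ball (by linarith))
  have hcρ : c ∈ closedBall c ρ := mem_closedBall_self hρ0.le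
  -- Linearisation of the Riccati equation: `P = -2 y' / y` and `y'' = -(P' - P² / 2) / 2 * y`. As
  -- an exponential, `y` has no zeros.
  set y : ℂ → ℂ := fun z => Complex.exp (-L z / 2) with hy
  set y' : ℂ → ℂ := fun z => -P z / 2 * y z with hy'
  have hyd : ∀ z ∈ ball c d, HasDerivAt y (y' z) z := fun z hz =>
    ((hL z hz).neg.div_const 2).cexp.congr_deriv (by simp only [hy', hy, Pi.neg_apply]; ring)
  have hyd' : ∀ z ∈ ball c d, HasDerivAt y' (-(deriv P z - P z ^ 2 / 2) / 2 * y z) z := by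
    intro z hz
    have h1 := (hP.differentiableAt (isOpen_ball.mem_nhds hz)).hasDerivAt
    exact ((h1.neg.div_const 2).mul (hyd z hz)).congr_deriv (by simp only [hy', Pi.neg_apply]; ring)
  obtain ⟨w, hw, hmax⟩ := (isCompact_closedBall c ρ).exists_isMaxOn ⟨c, hcρ⟩
    (f := fun z => ‖y' z‖)
    (fun z hz => (hyd' z (hsub' hz)).continuousAt.continuousWithinAt.norm)
  set Y := ‖y' w‖ with hY
  have hmax' : ∀ z ∈ closedBall c ρ, ‖y' z‖ ≤ Y := fun z hz => hmax hz
  have hY0 : 0 ≤ Y := norm_nonneg _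
  have hyc : y c = 1 := by simp [hy, hLc]
  have hyb : ∀ z ∈ closedBall c ρ, ‖y z‖ ≤ 1 + ρ * Y := by
    intro z hz
    have h1 := norm_sub_le_of_hasDerivAt (convex_closedBall c ρ)
      (fun z hz => hyd z (hsub' hz)) hmax' hcρ hz
    have h2 : ‖z - c‖ ≤ ρ := by simpa [dist_eq_norm] using hz
    have h3 := norm_sub_norm_le (y z) (y c)
    rw [hyc] at h1 h3
    rw [norm_one] at h3
    nlinarith
  set a := ‖y' c‖ with ha
  -- Integrating `y''` from `c` brings back the maximum `Y` of `|y'|`, but with factor `1 / 8`, so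
  -- it can be absorbed at the maximum point `w`.
  have hdev : ∀ z ∈ closedBall c ρ, ‖y' z - y' c‖ ≤ 1 / (16 * d) + Y / 8 := by
    intro z hz
    have hb : ∀ z ∈ closedBall c ρ, ‖-(deriv P z - P z ^ 2 / 2) / 2 * y z‖ ≤
        K / d ^ 2 * (1 + ρ * Y) / 2 + M / d * Y := by
      intro z hz
      have h1 := hbound z (hsub hz)
      have h2 : ‖P z‖ * ‖y z‖ = 2 * ‖y' z‖ := by
        simp only [hy', norm_mul, norm_div, norm_neg, Complex.norm_ofNat]; ring
      rw [norm_mul, norm_div, norm_neg, Complex.norm_ofNat]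
      calc ‖deriv P z - P z ^ 2 / 2‖ / 2 * ‖y z‖ ≤ (K / d ^ 2 + M / d * ‖P z‖) / 2 * ‖y z‖ := by
            gcongr
        _ = K / d ^ 2 * ‖y z‖ / 2 + M / d * (‖P z‖ * ‖y z‖) / 2 := by ring
        _ = K / d ^ 2 * ‖y z‖ / 2 + M / d * ‖y' z‖ := by rw [h2]; ring
        _ ≤ _ := by
          have := hyb z hz
          have := hmax' z hz
          gcongr
    have h1 := norm_sub_le_of_hasDerivAt (convex_closedBall c ρ)
      (fun z hz => hyd' z (hsub' hz)) hb hcρ hz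
    have h2 : ‖z - c‖ ≤ ρ := by simpa [dist_eq_norm] using hz
    refine h1.trans ((mul_le_mul_of_nonneg_left h2 (by positivity)).trans ?_)
    have e : (K / d ^ 2 * (1 + ρ * Y) / 2 + M / d * Y) * ρ =
        (s * K) / (2 * d) + ((s * K) * s / 2 + s * M) * Y := by
      rw [hρ]; field_simp; ring
    rw [e]
    have e1 : s * K / (2 * d) ≤ 1 / (16 * d) := by
      rw [div_le_div_iff₀ (by positivity) (by positivity)]; nlinarith
    have e2 : (s * K) * s / 2 + s * M ≤ 1 / 8 := by
      have : (s * K) * s ≤ 1 / 16 * (1 / 16) := by gcongr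
      linarith
    nlinarith
  have hYa : Y ≤ 8 / 7 * (a + 1 / (16 * d)) := by
    have h1 := hdev w hw
    have h2 := norm_sub_norm_le (y' w) (y' c)
    linarith
  have hda : 0 < 1 / (16 * d) := by positivity
  have hdev' : ∀ z ∈ closedBall c ρ, ‖y' z - y' c‖ ≤ a / 7 + 2 * (1 / (16 * d)) := by
    intro z hz
    have := hdev z hz
    linarith
  have hlow : ∀ z ∈ closedBall c ρ, ‖y z - 1 - y' c * (z - c)‖ ≤
      (a / 7 + 2 * (1 / (16 * d))) * ρ := by
    intro z hz
    have h1 := norm_sub_le_of_hasDerivAt (f := fun z => y z - y' c * z)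
      (f' := fun z => y' z - y' c) (convex_closedBall c ρ)
      (fun z hz => ((hyd z (hsub' hz)).sub ((hasDerivAt_id z).const_mul (y' c))).congr_deriv
        (by simp)) hdev' hcρ hz
    have h2 : ‖z - c‖ ≤ ρ := by simpa [dist_eq_norm] using hz
    have h3 : y z - 1 - y' c * (z - c) = y z - y' c * z - (y c - y' c * c) := by rw [hyc]; ring
    rw [h3]
    exact h1.trans (mul_le_mul_of_nonneg_left h2 (by positivity))
  have haP : ‖P c‖ = 2 * a := by
    simp only [ha, hy', hyc, norm_mul, norm_div, norm_neg, Complex.norm_ofNat, norm_one]; ring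
  rw [le_div_iff₀ hs0, haP]
  -- If `P c` is too large, the nearly affine `y` has modulus at least `3 / 2` on the circle
  -- although `y c = 1`. The maximum principle for `1 / y` forbids this.
  by_contra! hcon
  have haρ : 7 / 2 < a * ρ := by rw [hρ]; linarith
  have hsph : ∀ z ∈ sphere c ρ, 3 / 2 ≤ ‖y z‖ := by
    intro z hz
    have h1 := hlow z (sphere_subset_closedBall hz)
    have h2 : ‖z - c‖ = ρ := by simpa [dist_eq_norm] using hz
    have h3 : ‖y' c * (z - c)‖ = a * ρ := by rw [norm_mul, h2]
    have h4 : ‖y' c * (z - c)‖ ≤ ‖y z‖ + 1 + ‖y z - 1 - y' c * (z - c)‖ := by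
      have : y' c * (z - c) = y z - 1 - (y z - 1 - y' c * (z - c)) := by ring
      calc _ = ‖y z - 1 - (y z - 1 - y' c * (z - c))‖ := by rw [← this]
        _ ≤ ‖y z - 1‖ + _ := norm_sub_le _ _
        _ ≤ _ := by
          have := norm_sub_le (y z) 1
          rw [norm_one] at this
          linarith
    have h5 : (a / 7 + 2 * (1 / (16 * d))) * ρ = a * ρ / 7 + s / 8 := by
      rw [hρ]; field_simp; ring
    linarith
  have hinv := Complex.norm_le_of_forall_mem_frontier_norm_le (f := fun z => (y z)⁻¹)
    (U := ball c ρ) (C := 2 / 3) isBounded_ball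
    (DifferentiableOn.diffContOnCl_ball (U := closedBall c ρ)
      (fun z hz => ((hyd z (hsub' hz)).inv
        (Complex.exp_ne_zero _)).differentiableAt.differentiableWithinAt) subset_rfl)
    (fun z hz => by
      have h1 := hsph z (frontier_ball_subset_sphere hz)
      rw [norm_inv, inv_le_comm₀ (by linarith) (by norm_num)]
      norm_num; exact h1)
    (subset_closure (mem_ball_self hρ0))
  rw [hyc] at hinv
  norm_num at hinv

/-! ### Harmonic pre-Schwarzian and Schwarzian norms against `h'' / h'`. -/

section SensePreserving

variable {h g : ℂ → ℂ}

namespace IsSensePreservingHarmonic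

lemma norm_deriv_lt (hf : IsSensePreservingHarmonic h g) {z : ℂ} (hz : z ∈ unitDisk) :
    ‖deriv g z‖ < ‖deriv h z‖ := by
  have := hf.jacobian_pos z hz
  exact lt_of_pow_lt_pow_left₀ 2 (norm_nonneg _) (by linarith)

lemma deriv_ne_zero (hf : IsSensePreservingHarmonic h g) {z : ℂ} (hz : z ∈ unitDisk) :
    deriv h z ≠ 0 :=
  norm_pos_iff.1 ((norm_nonneg _).trans_lt (hf.norm_deriv_lt hz))

lemma differentiableOn_dilatation (hf : IsSensePreservingHarmonic h g) :
    DifferentiableOn ℂ (dilatation h g) unitDisk :=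
  (hf.analytic_g.deriv isOpen_unitDisk).fun_div (hf.analytic_h.deriv isOpen_unitDisk)
    fun _ hz => hf.deriv_ne_zero hz

lemma norm_dilatation_lt (hf : IsSensePreservingHarmonic h g) (z : ℂ) (hz : z ∈ unitDisk) :
    ‖dilatation h g z‖ < 1 := by
  rw [dilatation, norm_div, div_lt_one (norm_pos_iff.2 (hf.deriv_ne_zero hz))]
  exact hf.norm_deriv_lt hz

lemma deriv_g_eq (hf : IsSensePreservingHarmonic h g) {z : ℂ} (hz : z ∈ unitDisk) :
    deriv g z = dilatation h g z * deriv h z :=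
  (div_mul_cancel₀ _ (hf.deriv_ne_zero hz)).symm

lemma hasDerivAt_deriv_h (hf : IsSensePreservingHarmonic h g) {z : ℂ} (hz : z ∈ unitDisk) :
    HasDerivAt (deriv h) (deriv (deriv h) z) z :=
  ((hf.analytic_h.deriv isOpen_unitDisk).differentiableAt (isOpen_unitDisk.mem_nhds hz)).hasDerivAt

lemma hasDerivAt_dilatation (hf : IsSensePreservingHarmonic h g) {z : ℂ} (hz : z ∈ unitDisk) :
    HasDerivAt (dilatation h g) (deriv (dilatation h g) z) z :=
  (hf.differentiableOn_dilatation.differentiableAt (isOpen_unitDisk.mem_nhds hz)).hasDerivAt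

lemma deriv_deriv_g_eq (hf : IsSensePreservingHarmonic h g) {z : ℂ} (hz : z ∈ unitDisk) :
    deriv (deriv g) z =
      deriv (dilatation h g) z * deriv h z + dilatation h g z * deriv (deriv h) z := by
  rw [← ((hf.hasDerivAt_dilatation hz).mul (hf.hasDerivAt_deriv_h hz)).deriv]
  apply Filter.EventuallyEq.deriv_eq
  filter_upwards [isOpen_unitDisk.mem_nhds hz] with w hw using hf.deriv_g_eq hw

/-- With `g' = ω h'` the factor `|h'|²` cancels. The remaining correction depends on `ω` only, and
Schwarz–Pick controls it. -/
lemma preSchwarzian_eq (hf : IsSensePreservingHarmonic h g) {z : ℂ} (hz : z ∈ unitDisk) :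
    preSchwarzian h g z = deriv (deriv h) z / deriv h z -
      conj (dilatation h g z) * deriv (dilatation h g) z /
        ((1 - ‖dilatation h g z‖ ^ 2 : ℝ) : ℂ) := by
  have h0 := hf.deriv_ne_zero hz
  have h1 : ((1 - ‖dilatation h g z‖ ^ 2 : ℝ) : ℂ) ≠ 0 :=
    Complex.ofReal_ne_zero.2 (one_sub_sq_pos hf.norm_dilatation_lt hz).ne'
  have h2 : conj (deriv h z) ≠ 0 := (map_ne_zero _).2 h0
  have h3 : ((‖deriv h z‖ ^ 2 - ‖dilatation h g z * deriv h z‖ ^ 2 : ℝ) : ℂ) =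
      deriv h z * conj (deriv h z) * ((1 - ‖dilatation h g z‖ ^ 2 : ℝ) : ℂ) := by
    rw [Complex.mul_conj, Complex.normSq_eq_norm_sq, norm_mul]
    push_cast; ring
  rw [preSchwarzian, hf.deriv_g_eq hz, h3, hf.deriv_deriv_g_eq hz, map_mul]
  have h4 := one_sub_conj_mul_self (dilatation h g z)
  field_simp
  rw [← h4]
  ring

lemma norm_conj_mul_deriv_dilatation_le (hf : IsSensePreservingHarmonic h g) {z : ℂ}
    (hz : z ∈ unitDisk) :
    (1 - ‖z‖ ^ 2) * ‖conj (dilatation h g z) * deriv (dilatation h g) z /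
        ((1 - ‖dilatation h g z‖ ^ 2 : ℝ) : ℂ)‖ ≤ 2 := by
  have h1 := one_sub_sq_pos hf.norm_dilatation_lt hz
  have h2 := norm_deriv_le_of_selfMap hf.differentiableOn_dilatation hf.norm_dilatation_lt hz
  have h3 := hf.norm_dilatation_lt z hz
  have h0 : 0 ≤ 1 - ‖z‖ ^ 2 := (one_sub_norm_pos hz).le.trans (le_one_sub_sq hz)
  rw [norm_div, Complex.norm_of_nonneg h1.le, norm_mul, Complex.norm_conj, ← mul_div_assoc,
    div_le_iff₀ h1]
  have : ‖dilatation h g z‖ * ((1 - ‖z‖ ^ 2) * ‖deriv (dilatation h g) z‖) ≤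
      1 * ((1 - ‖z‖ ^ 2) * ‖deriv (dilatation h g) z‖) := by gcongr
  linarith

lemma boundedPSN_iff (hf : IsSensePreservingHarmonic h g) : BoundedPSN h g ↔ PreBdd h := by
  rw [BoundedPSN, preSchwarzianNorm, iSup_ofReal_lt_top_iff, PreBdd]
  refine exists_bound_iff_of_sub (q := fun z => deriv (deriv h) z / deriv h z) (K := 2)
    fun z hz => ?_
  rw [hf.preSchwarzian_eq hz, sub_sub_cancel_left, norm_neg]
  exact hf.norm_conj_mul_deriv_dilatation_le hz

lemma analyticSchwarzian_eq (hf : IsSensePreservingHarmonic h g) {z : ℂ} (hz : z ∈ unitDisk) :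
    analyticSchwarzian h z = deriv (fun w => deriv (deriv h) w / deriv h w) z -
      (deriv (deriv h) z / deriv h z) ^ 2 / 2 := by
  have h0 := hf.deriv_ne_zero hz
  have h1 := (((hf.analytic_h.deriv isOpen_unitDisk).deriv isOpen_unitDisk).differentiableAt
    (isOpen_unitDisk.mem_nhds hz)).hasDerivAt
  rw [(h1.fun_div (hf.hasDerivAt_deriv_h hz) h0).deriv, analyticSchwarzian]
  field_simp
  ring

/-- The Schwarzian of `h + conj g` differs from that of `h` by at most a multiple of the
pre-Schwarzian of `h`, in hyperbolic norms. -/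
lemma norm_schwarzian_sub_le (hf : IsSensePreservingHarmonic h g) {z : ℂ} (hz : z ∈ unitDisk) :
    (1 - ‖z‖ ^ 2) ^ 2 * ‖schwarzian h g z - analyticSchwarzian h z‖ ≤
      2 * ((1 - ‖z‖ ^ 2) * ‖deriv (deriv h) z / deriv h z‖) + 134 := by
  have h1 := one_sub_sq_pos hf.norm_dilatation_lt hz
  have h2 := norm_deriv_deriv_le_of_selfMap hf.differentiableOn_dilatation hf.norm_dilatation_lt hz
  have h3 := hf.norm_dilatation_lt z hz
  have h4 := hf.norm_conj_mul_deriv_dilatation_le hz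
  have h0 : 0 ≤ 1 - ‖z‖ ^ 2 := (one_sub_norm_pos hz).le.trans (le_one_sub_sq hz)
  set ω := dilatation h g with hω
  set A := conj (ω z) * deriv ω z / ((1 - ‖ω z‖ ^ 2 : ℝ) : ℂ) with hA
  set B := conj (ω z) * deriv (deriv ω) z / ((1 - ‖ω z‖ ^ 2 : ℝ) : ℂ) with hB
  have h5 : (1 - ‖z‖ ^ 2) ^ 2 * ‖B‖ ≤ 128 := by
    rw [hB, norm_div, Complex.norm_of_nonneg h1.le, norm_mul, Complex.norm_conj, ← mul_div_assoc,
      div_le_iff₀ h1]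
    have : ‖ω z‖ * ((1 - ‖z‖ ^ 2) ^ 2 * ‖deriv (deriv ω) z‖) ≤
        1 * ((1 - ‖z‖ ^ 2) ^ 2 * ‖deriv (deriv ω) z‖) := by gcongr
    linarith
  -- With `t = 1 - |z|²`, the bounds `t|A| ≤ 2` and `t²|B| ≤ 128` give the constant `134 = 128 + (3
  -- / 2) * 2²`.
  have h6 : schwarzian h g z - analyticSchwarzian h z =
      A * (deriv (deriv h) z / deriv h z) - B - 3 / 2 * A ^ 2 := by
    simp only [schwarzian, ← hω, hA, hB]
    ring
  rw [h6]
  set p := deriv (deriv h) z / deriv h z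
  have h7 : ‖A * p - B - 3 / 2 * A ^ 2‖ ≤ ‖A‖ * ‖p‖ + ‖B‖ + 3 / 2 * ‖A‖ ^ 2 := by
    refine (norm_sub_le _ _).trans (add_le_add ((norm_sub_le _ _).trans ?_) ?_)
    · rw [norm_mul]
    · rw [norm_mul, norm_pow]; norm_num
  set t := 1 - ‖z‖ ^ 2
  have h8 : (t * ‖A‖) * (t * ‖p‖) ≤ 2 * (t * ‖p‖) := by gcongr
  have h9 : (t * ‖A‖) ^ 2 ≤ 2 ^ 2 := by gcongr
  calc t ^ 2 * ‖A * p - B - 3 / 2 * A ^ 2‖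
      ≤ t ^ 2 * (‖A‖ * ‖p‖ + ‖B‖ + 3 / 2 * ‖A‖ ^ 2) := by gcongr
    _ = (t * ‖A‖) * (t * ‖p‖) + t ^ 2 * ‖B‖ + 3 / 2 * (t * ‖A‖) ^ 2 := by ring
    _ ≤ _ := by linarith

lemma differentiableOn_pre (hf : IsSensePreservingHarmonic h g) :
    DifferentiableOn ℂ (fun w => deriv (deriv h) w / deriv h w) unitDisk :=
  ((hf.analytic_h.deriv isOpen_unitDisk).deriv isOpen_unitDisk).fun_div
    (hf.analytic_h.deriv isOpen_unitDisk) fun _ hz => hf.deriv_ne_zero hz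

/-- Cauchy's estimate on the circle of half the distance to the boundary bounds `p'`, and hence `p'
- p² / 2`. -/
lemma boundedSN_of_preBdd (hf : IsSensePreservingHarmonic h g) (hp : PreBdd h) :
    BoundedSN h g := by
  rw [BoundedSN, schwarzianNorm, iSup_ofReal_lt_top_iff]
  obtain ⟨C, hC⟩ := hp
  refine ⟨16 * C + C ^ 2 / 2 + (2 * C + 134), fun z hz => ?_⟩
  set p : ℂ → ℂ := fun w => deriv (deriv h) w / deriv h w with hp
  have h0 := one_sub_norm_pos hz
  set d := 1 - ‖z‖ with hd
  have hsub := ball_subset_unitDisk (c := z) (d := d) le_rfl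
  have hcl : closedBall z (d / 2) ⊆ ball z d := closedBall_subset_ball (by linarith)
  have hder := Complex.norm_deriv_le_of_forall_mem_sphere_norm_le (f := p) (c := z)
    (R := d / 2) (C := 2 * C / d) (by linarith)
    ((hf.differentiableOn_pre.mono (hcl.trans hsub)).diffContOnCl_ball subset_rfl) (by
      intro w hw
      have hwD := hsub (hcl (sphere_subset_closedBall hw))
      have hwn : ‖w - z‖ = d / 2 := by simpa [dist_eq_norm] using hw
      have h1 := hC w hwD
      have h2 : d / 2 ≤ 1 - ‖w‖ := by
        have := norm_sub_norm_le w z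
        linarith
      rw [le_div_iff₀ h0]
      have h3 := mul_le_mul_of_nonneg_right (h2.trans (le_one_sub_sq hwD)) (norm_nonneg (p w))
      linarith)
  have h2d := one_sub_sq_le z
  have hle := le_one_sub_sq hz
  set t := 1 - ‖z‖ ^ 2
  have ht0 : 0 ≤ t := by linarith
  rw [div_div, le_div_iff₀ (by positivity)] at hder
  have h1 : t ^ 2 * ‖deriv p z‖ ≤ 16 * C := by
    have : t ^ 2 ≤ (2 * d) ^ 2 := by gcongr
    nlinarith [mul_le_mul_of_nonneg_right this (norm_nonneg (deriv p z))]
  have h2 := hC z hz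
  have h3 : (t * ‖p z‖) ^ 2 ≤ C ^ 2 := pow_le_pow_left₀ (by positivity) h2 2
  have h4 := hf.norm_schwarzian_sub_le hz
  have h5 : ‖schwarzian h g z‖ ≤ ‖deriv p z‖ + ‖p z‖ ^ 2 / 2 +
      ‖schwarzian h g z - analyticSchwarzian h z‖ := by
    have e : schwarzian h g z =
        (deriv p z - p z ^ 2 / 2) + (schwarzian h g z - analyticSchwarzian h z) := by
      rw [hf.analyticSchwarzian_eq hz]; ring
    rw [e]
    refine (norm_add_le _ _).trans ?_
    rw [← e]
    gcongr
    refine (norm_sub_le _ _).trans ?_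
    rw [norm_div, norm_pow]; norm_num
  calc t ^ 2 * ‖schwarzian h g z‖ ≤ t ^ 2 * (‖deriv p z‖ + ‖p z‖ ^ 2 / 2 +
        ‖schwarzian h g z - analyticSchwarzian h z‖) := by gcongr
    _ = t ^ 2 * ‖deriv p z‖ + (t * ‖p z‖) ^ 2 / 2 +
        t ^ 2 * ‖schwarzian h g z - analyticSchwarzian h z‖ := by ring
    _ ≤ _ := by
      have : t * ‖p z‖ ≤ C := h2
      linarith

/-- The correction `S_f - S_h` contains `p` itself, so a bound on `S_f` bounds `p' - p² / 2` only up
to a term linear in `p`. The term `M / d * ‖P z‖` in `exists_riccati_bound` allows for this. -/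
lemma preBdd_of_boundedSN (hf : IsSensePreservingHarmonic h g) (hs : BoundedSN h g) :
    PreBdd h := by
  rw [BoundedSN, schwarzianNorm, iSup_ofReal_lt_top_iff] at hs
  obtain ⟨C, hC⟩ := hs
  set p : ℂ → ℂ := fun w => deriv (deriv h) w / deriv h w with hp
  obtain ⟨B, hB⟩ := exists_riccati_bound (K := 4 * (|C| + 134)) (M := 4) (by positivity) (by norm_num)
  refine ⟨2 * B, fun c hc => ?_⟩
  have h0 := one_sub_norm_pos hc
  set d := 1 - ‖c‖ with hd
  have hsub := ball_subset_unitDisk (c := c) (d := d) le_rfl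
  have key := hB c d p h0 (hf.differentiableOn_pre.mono hsub) (by
    intro z hz
    have hzD := hsub (ball_subset_ball (by linarith) hz)
    have hzn : ‖z - c‖ < d / 2 := by simpa [dist_eq_norm] using hz
    have h2 : d / 2 ≤ 1 - ‖z‖ := by
      have := norm_sub_norm_le z c
      linarith
    have h3 := h2.trans (le_one_sub_sq hzD)
    rw [← hf.analyticSchwarzian_eq hzD]
    have h4 := hf.norm_schwarzian_sub_le hzD
    have h5 := hC z hzD
    have h6 : ‖analyticSchwarzian h z‖ ≤
        ‖schwarzian h g z‖ + ‖schwarzian h g z - analyticSchwarzian h z‖ := by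
      have := norm_sub_le (schwarzian h g z) (schwarzian h g z - analyticSchwarzian h z)
      simpa using this
    set t := 1 - ‖z‖ ^ 2
    have h7 : t ^ 2 * ‖analyticSchwarzian h z‖ ≤ |C| + 134 + 2 * (t * ‖p z‖) := by
      have := mul_le_mul_of_nonneg_left h6 (sq_nonneg t)
      have := le_abs_self C
      have : (1 - ‖z‖ ^ 2) * ‖deriv (deriv h) z / deriv h z‖ = t * ‖p z‖ := rfl
      linarith
    have ht0 : 0 < t := by linarith
    have h8 : ‖analyticSchwarzian h z‖ ≤ (|C| + 134) / t ^ 2 + 2 / t * ‖p z‖ := by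
      have : (|C| + 134) / t ^ 2 + 2 / t * ‖p z‖ = (|C| + 134 + 2 * (t * ‖p z‖)) / t ^ 2 := by
        field_simp
      rw [this, le_div_iff₀ (by positivity)]
      linarith
    refine h8.trans (add_le_add ?_ ?_)
    · have : 4 * (|C| + 134) / d ^ 2 = (|C| + 134) / (d / 2) ^ 2 := by field_simp; norm_num
      rw [this]
      gcongr
    · have : 4 / d = 2 / (d / 2) := by field_simp; norm_num
      rw [this]
      gcongr)
  have h2d := one_sub_sq_le c
  have : (1 - ‖c‖ ^ 2) * ‖p c‖ ≤ (2 * d) * ‖p c‖ := by gcongr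
  linarith

lemma boundedSN_iff (hf : IsSensePreservingHarmonic h g) : BoundedSN h g ↔ PreBdd h :=
  ⟨hf.preBdd_of_boundedSN, hf.boundedSN_of_preBdd⟩

end IsSensePreservingHarmonic

end SensePreserving

/-! ### Hyperbolic disks, Euclidean balls, and the two uniform local properties. -/

lemma mem_hypDisk_iff {a z : ℂ} {k : ℝ} (hk0 : 0 < k) (hk1 : k < 1) (ha : a ∈ unitDisk) :
    z ∈ hypDisk a (ENNReal.ofReal (2 * Real.artanh k)) ↔
      z ∈ unitDisk ∧ ‖(z - a) / (1 - conj a * z)‖ < k := by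
  refine and_congr_right fun hz => ?_
  have h1 : 0 < 2 * Real.artanh k := by
    have := Real.artanh_pos ⟨hk0, hk1⟩
    linarith
  have h2 := norm_mobius_lt_one (mem_unitDisk.1 ha) (mem_unitDisk.1 hz)
  rw [ENNReal.ofReal_lt_ofReal_iff h1, hypDist, mul_lt_mul_iff_right₀ (by norm_num),
    Real.artanh_lt_artanh_iff ⟨by linarith [norm_nonneg ((z - a) / (1 - conj a * z))], h2⟩
      ⟨by linarith, hk1⟩]

/-- A hyperbolic disk of the unit disk is a Euclidean disk. -/
lemma hypDisk_eq_ball {a : ℂ} {k : ℝ} (hk0 : 0 < k) (hk1 : k < 1) (ha : a ∈ unitDisk) :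
    hypDisk a (ENNReal.ofReal (2 * Real.artanh k)) =
      ball (((1 - k ^ 2) / (1 - k ^ 2 * ‖a‖ ^ 2) : ℝ) * a)
        (k * (1 - ‖a‖ ^ 2) / (1 - k ^ 2 * ‖a‖ ^ 2)) := by
  have ha1 := mem_unitDisk.1 ha
  have ha0 := norm_nonneg a
  have hka : k * ‖a‖ < 1 := by nlinarith
  have hN : 0 < 1 - k ^ 2 * ‖a‖ ^ 2 := by
    have : 0 < (1 - k * ‖a‖) * (1 + k * ‖a‖) := by apply mul_pos <;> nlinarith
    nlinarith
  set N := 1 - k ^ 2 * ‖a‖ ^ 2 with hNdef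
  have h1a : 0 < 1 - ‖a‖ ^ 2 := by nlinarith
  ext z
  rw [mem_hypDisk_iff hk0 hk1 ha, mem_ball, dist_eq_norm]
  -- Completing the square: the Euclidean and the pseudohyperbolic condition are sign conditions on
  -- one quadratic expression.
  have key : (N * ‖z - ((1 - k ^ 2) / N : ℝ) * a‖) ^ 2 - (k * (1 - ‖a‖ ^ 2)) ^ 2 =
      N * (‖z - a‖ ^ 2 - k ^ 2 * ‖1 - conj a * z‖ ^ 2) := by
    have e : N * ‖z - ((1 - k ^ 2) / N : ℝ) * a‖ = ‖(N : ℂ) * z - (1 - k ^ 2 : ℝ) * a‖ := by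
      rw [← Complex.norm_of_nonneg hN.le, ← norm_mul, Complex.norm_of_nonneg hN.le]
      congr 1
      have : (N : ℂ) ≠ 0 := Complex.ofReal_ne_zero.2 hN.ne'
      push_cast
      field_simp
    rw [e, hNdef]
    simp only [← Complex.normSq_eq_norm_sq, Complex.normSq_apply, Complex.sub_re, Complex.sub_im,
      Complex.mul_re, Complex.mul_im, Complex.ofReal_re, Complex.ofReal_im, Complex.conj_re,
      Complex.conj_im, Complex.one_re, Complex.one_im]
    ring
  have iff1 : ‖z - ((1 - k ^ 2) / N : ℝ) * a‖ < k * (1 - ‖a‖ ^ 2) / N ↔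
      ‖z - a‖ ^ 2 < k ^ 2 * ‖1 - conj a * z‖ ^ 2 := by
    rw [lt_div_iff₀ hN, mul_comm _ N, ← sq_lt_sq₀ (by positivity) (by positivity)]
    constructor
    · intro h
      have : N * (‖z - a‖ ^ 2 - k ^ 2 * ‖1 - conj a * z‖ ^ 2) < 0 := by linarith
      have := (pos_iff_neg_of_mul_neg this).1 hN
      linarith
    · intro h
      have : N * (‖z - a‖ ^ 2 - k ^ 2 * ‖1 - conj a * z‖ ^ 2) < 0 :=
        mul_neg_of_pos_of_neg hN (by linarith)
      linarith
  have iff2 : z ∈ unitDisk → (‖(z - a) / (1 - conj a * z)‖ < k ↔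
      ‖z - a‖ ^ 2 < k ^ 2 * ‖1 - conj a * z‖ ^ 2) := by
    intro hz
    have h0 := norm_pos_iff.2 (one_sub_conj_mul_ne_zero ha1 (mem_unitDisk.1 hz))
    rw [norm_div, div_lt_iff₀ h0, ← sq_lt_sq₀ (norm_nonneg _) (by positivity), mul_pow]
  constructor
  · rintro ⟨hz, h⟩
    exact iff1.2 ((iff2 hz).1 h)
  · intro h
    have hz : z ∈ unitDisk := by
      rw [mem_unitDisk]
      have e1 : ‖(((1 - k ^ 2) / N : ℝ) : ℂ) * a‖ = (1 - k ^ 2) / N * ‖a‖ := by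
        rw [norm_mul, Complex.norm_of_nonneg (div_nonneg (by nlinarith) hN.le)]
      have e2 := norm_sub_norm_le z (((1 - k ^ 2) / N : ℝ) * a)
      -- After clearing `N`, the difference of the two sides is `(1 - |a|)(1 - k)(1 - k|a|)`.
      have e3 : (1 - k ^ 2) / N * ‖a‖ + k * (1 - ‖a‖ ^ 2) / N ≤ 1 := by
        rw [div_mul_eq_mul_div, ← add_div, div_le_one hN]
        have : 0 ≤ (1 - ‖a‖) * ((1 - k) * (1 - k * ‖a‖)) :=
          mul_nonneg (by linarith) (mul_nonneg (by linarith) (by linarith))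
        rw [hNdef]; linarith
      linarith
    exact ⟨hz, (iff2 hz).2 (iff1.1 h)⟩

/-- Convexity of the image does not pass to subsets, so the hypothesis covers all small balls. A
hyperbolic disk about `a` is one of them, with a Euclidean centre different from `a` in general. -/
lemma ulc_of_convexIn_ball {F : ℂ → ℂ} {s : ℝ} (hs : 0 < s)
    (h : ∀ c ∈ unitDisk, ∀ r, 0 < r → r ≤ s * (1 - ‖c‖) → ConvexIn F (ball c r)) : ULC F := by
  set k := min (s / 2) (1 / 2) with hk
  have hk0 : 0 < k := by positivity
  have hk1 : k < 1 := (min_le_right _ _).trans_lt (by norm_num)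
  have hks : 2 * k ≤ s := by linarith [min_le_left (s / 2) (1 / 2)]
  have hpos : 0 < ENNReal.ofReal (2 * Real.artanh k) := by
    have := Real.artanh_pos ⟨hk0, hk1⟩
    simpa using this
  refine hpos.trans_le (le_iInf₂ fun a ha => le_sSup ⟨hpos, ?_⟩)
  have ha1 := mem_unitDisk.1 ha
  have ha0 := norm_nonneg a
  have hka : k * ‖a‖ < 1 := by nlinarith
  have hN : 0 < 1 - k ^ 2 * ‖a‖ ^ 2 := by
    have : 0 < (1 - k * ‖a‖) * (1 + k * ‖a‖) := by apply mul_pos <;> nlinarith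
    nlinarith
  rw [hypDisk_eq_ball hk0 hk1 ha]
  have e1 : ‖(((1 - k ^ 2) / (1 - k ^ 2 * ‖a‖ ^ 2) : ℝ) : ℂ) * a‖ =
      (1 - k ^ 2) / (1 - k ^ 2 * ‖a‖ ^ 2) * ‖a‖ := by
    rw [norm_mul, Complex.norm_of_nonneg (div_nonneg (by nlinarith) hN.le)]
  have h1a : 0 < 1 - ‖a‖ ^ 2 := by nlinarith
  have e2 : 1 - (1 - k ^ 2) / (1 - k ^ 2 * ‖a‖ ^ 2) * ‖a‖ =
      (1 - ‖a‖) * (1 + k ^ 2 * ‖a‖) / (1 - k ^ 2 * ‖a‖ ^ 2) := by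
    field_simp; ring
  have e3 : 0 < (1 - ‖a‖) * (1 + k ^ 2 * ‖a‖) / (1 - k ^ 2 * ‖a‖ ^ 2) :=
    div_pos (mul_pos (by linarith) (by positivity)) hN
  refine h _ ?_ _ (by positivity) ?_
  · rw [mem_unitDisk, e1]; linarith
  · rw [e1, e2]
    calc k * (1 - ‖a‖ ^ 2) / (1 - k ^ 2 * ‖a‖ ^ 2)
        ≤ (2 * k * ((1 - ‖a‖) * (1 + k ^ 2 * ‖a‖))) / (1 - k ^ 2 * ‖a‖ ^ 2) := by
          refine div_le_div_of_nonneg_right ?_ hN.le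
          have h1 : 1 - ‖a‖ ^ 2 ≤ 2 * ((1 - ‖a‖) * (1 + k ^ 2 * ‖a‖)) := by
            have : 0 ≤ (1 - ‖a‖) * (k ^ 2 * ‖a‖) := mul_nonneg (by linarith) (by positivity)
            nlinarith [one_sub_sq_le a]
          nlinarith
      _ = 2 * k * ((1 - ‖a‖) * (1 + k ^ 2 * ‖a‖) / (1 - k ^ 2 * ‖a‖ ^ 2)) := by ring
      _ ≤ _ := by gcongr

lemma ULC.ulu {F : ℂ → ℂ} (h : ULC F) : ULU F :=
  h.trans_le (iInf₂_mono fun _ _ => sSup_le_sSup fun _ hρ => ⟨hρ.1, hρ.2.1⟩)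

/-- Injectivity passes to subsets, so a ball inside the hyperbolic disk suffices: `|z - c| < k(1 -
|c|)` implies `|z - c| < k|1 - conj c * z|`. -/
lemma ULU.exists_injOn_ball {F : ℂ → ℂ} (h : ULU F) :
    ∃ s : ℝ, 0 < s ∧ s ≤ 1 / 2 ∧ ∀ c ∈ unitDisk, InjOn F (ball c (s * (1 - ‖c‖))) := by
  -- A strictly smaller `ρ` is finite, and lies below an admissible radius at each centre even where
  -- the supremum is not attained.
  obtain ⟨ρ, hρ0, hρ⟩ := exists_between h
  have hρt : ρ ≠ ⊤ := (hρ.trans_le le_top).ne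
  have hρ' : 0 < ρ.toReal := ENNReal.toReal_pos hρ0.ne' hρt
  set t := Real.tanh (ρ.toReal / 2) with ht
  have ht0 : 0 < t := by
    rw [ht, Real.tanh_eq_sinh_div_cosh]
    exact div_pos (Real.sinh_pos_iff.2 (by linarith)) (Real.cosh_pos _)
  have ht1 : t < 1 := Real.tanh_lt_one _
  set k := min t (1 / 2) with hk
  have hk0 : 0 < k := by positivity
  have hk1 : k < 1 := (min_le_right _ _).trans_lt (by norm_num)
  have hkρ : ENNReal.ofReal (2 * Real.artanh k) ≤ ρ := by
    rw [ENNReal.ofReal_le_iff_le_toReal hρt]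
    have h1 := Real.artanh_le_artanh (by linarith) ht1 (min_le_left t (1 / 2))
    rw [ht, Real.artanh_tanh] at h1
    linarith
  refine ⟨k, hk0, min_le_right _ _, fun c hc => ?_⟩
  obtain ⟨ρ', ⟨-, hinj⟩, hρ'⟩ := lt_sSup_iff.1 (hρ.trans_le (iInf₂_le c hc))
  refine hinj.mono fun z hz => ?_
  have h0 := one_sub_norm_pos hc
  have hzD : z ∈ unitDisk := ball_subset_unitDisk (c := c) (d := 1 - ‖c‖) le_rfl
    (ball_subset_ball (by nlinarith) hz)
  have : z ∈ hypDisk c (ENNReal.ofReal (2 * Real.artanh k)) := by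
    rw [mem_hypDisk_iff hk0 hk1 hc]
    refine ⟨hzD, ?_⟩
    have hzn : ‖z - c‖ < k * (1 - ‖c‖) := by simpa [dist_eq_norm] using hz
    have h1 : 1 - ‖c‖ ≤ ‖1 - conj c * z‖ := by
      have h2 := norm_sub_norm_le (1 : ℂ) (conj c * z)
      rw [norm_one, norm_mul, Complex.norm_conj] at h2
      nlinarith [norm_nonneg c, mem_unitDisk.1 hzD]
    rw [norm_div, div_lt_iff₀ (h0.trans_le h1)]
    nlinarith
  exact ⟨this.1, this.2.trans_le (hkρ.trans hρ'.le)⟩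

/-! ### Perturbations of the identity and of the exponential. -/

/-- A perturbation of the identity covers a disk of the expected size. -/
lemma closedBall_subset_image {F : ℂ → ℂ} {b : ℂ} {ε c : ℝ} (hc : 0 ≤ c) (hε : 0 ≤ ε)
    (h : ∀ x ∈ closedBall b ε, ∀ y ∈ closedBall b ε, ‖F x - F y - (x - y)‖ ≤ c * ‖x - y‖) :
    closedBall (F b) ((1 - c) * ε) ⊆ F '' closedBall b ε := by
  have h1 : ApproximatesLinearOn F (ContinuousLinearMap.id ℝ ℂ) (closedBall b ε) ⟨c, hc⟩ :=
    fun x hx y hy => h x hx y hy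
  have h2 := h1.surjOn_closedBall_of_nonlinearRightInverse
    ⟨id, 1, fun y => by simp, fun y => rfl⟩ hε subset_rfl
  have h3 : SurjOn F (closedBall b ε) (closedBall (F b) (((1 : ℝ)⁻¹ - c) * ε)) := h2
  rwa [inv_one] at h3

/-- Images of small disks under `C²` perturbations of the identity are convex. -/
lemma convexIn_harm_ball {φ ψ : ℂ → ℂ} {c : ℂ} {r L : ℝ} (hr : 0 < r)
    (hφ : DifferentiableOn ℂ φ (ball c r)) (hψ : DifferentiableOn ℂ ψ (ball c r))
    (hφ1 : deriv φ c = 1) (hψ1 : deriv ψ c = 0)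
    (hφ2 : ∀ z ∈ ball c r, ‖deriv (deriv φ) z‖ ≤ L)
    (hψ2 : ∀ z ∈ ball c r, ‖deriv (deriv ψ) z‖ ≤ L) (hL : L * r ≤ 1 / 16) :
    ConvexIn (harm φ ψ) (ball c r) := by
  have hc : c ∈ ball c r := mem_ball_self hr
  have hL0 : 0 ≤ L := (norm_nonneg _).trans (hφ2 c hc)
  have hconv := convex_ball c r
  have der : ∀ {f : ℂ → ℂ}, DifferentiableOn ℂ f (ball c r) → ∀ z ∈ ball c r,
      HasDerivAt f (deriv f z) z := fun hf z hz =>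
    (hf.differentiableAt (isOpen_ball.mem_nhds hz)).hasDerivAt
  have der2 : ∀ {f : ℂ → ℂ}, DifferentiableOn ℂ f (ball c r) →
      (∀ z ∈ ball c r, ‖deriv (deriv f) z‖ ≤ L) → ∀ x ∈ ball c r, ∀ y ∈ ball c r,
      ‖deriv f y - deriv f x‖ ≤ L * ‖y - x‖ := fun hf hb x hx y hy =>
    norm_sub_le_of_hasDerivAt hconv (der (hf.deriv isOpen_ball)) hb hx hy
  have hlip : ∀ x ∈ ball c r, ∀ y ∈ ball c r,
      ‖harm φ ψ x - harm φ ψ y - (x - y)‖ ≤ 1 / 8 * ‖x - y‖ := by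
    intro x hx y hy
    have hz : ∀ z ∈ ball c r, L * ‖z - c‖ ≤ 1 / 16 := fun z hz => by
      have : ‖z - c‖ ≤ r := (by simpa [dist_eq_norm] using hz : ‖z - c‖ < r).le
      nlinarith
    have h1 := norm_sub_le_of_hasDerivAt (f := fun z => φ z - z) (f' := fun z => deriv φ z - 1)
      hconv (fun z hz => (der hφ z hz).sub (hasDerivAt_id z))
      (fun z hzz => by
        have := der2 hφ hφ2 c hc z hzz
        rw [hφ1] at this
        exact this.trans (hz z hzz)) hy hx
    have h2 := norm_sub_le_of_hasDerivAt hconv (der hψ)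
      (fun z hzz => by
        have := der2 hψ hψ2 c hc z hzz
        rw [hψ1, sub_zero] at this
        exact this.trans (hz z hzz)) hy hx
    have e : harm φ ψ x - harm φ ψ y - (x - y) =
        (φ x - x - (φ y - y)) + conj (ψ x - ψ y) := by
      simp only [harm, map_sub]; ring
    rw [e]
    refine (norm_add_le _ _).trans ?_
    rw [Complex.norm_conj]
    linarith
  have htaylor : ∀ {f : ℂ → ℂ}, DifferentiableOn ℂ f (ball c r) →
      (∀ z ∈ ball c r, ‖deriv (deriv f) z‖ ≤ L) → ∀ m ∈ ball c r, ∀ x ∈ ball c r,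
      ‖f x - f m - deriv f m * (x - m)‖ ≤ L * ‖x - m‖ * ‖x - m‖ := by
    intro f hf hb m hm x hx
    have hsub : segment ℝ m x ⊆ ball c r := hconv.segment_subset hm hx
    have := norm_sub_le_of_hasDerivAt (f := fun z => f z - deriv f m * z)
      (f' := fun z => deriv f z - deriv f m) (convex_segment m x)
      (fun z hz => ((der hf z (hsub hz)).sub ((hasDerivAt_id z).const_mul (deriv f m))).congr_deriv
        (by simp)) (fun z hz => (der2 hf hb m hm z (hsub hz)).trans
          (mul_le_mul_of_nonneg_left (norm_sub_le_of_mem_segment hz) hL0))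
      (left_mem_segment ℝ m x) (right_mem_segment ℝ m x)
    refine le_trans (le_of_eq ?_) this
    congr 1; ring
  refine ⟨fun x hx y hy hxy => ?_, ?_⟩
  · have := hlip x hx y hy
    rw [hxy, sub_self, zero_sub, norm_neg] at this
    have h0 : ‖x - y‖ = 0 := by linarith [norm_nonneg (x - y)]
    exact sub_eq_zero.1 (norm_eq_zero.1 h0)
  · rintro _ ⟨x, hx, rfl⟩ _ ⟨y, hy, rfl⟩ α β hα hβ hαβ
    set m := α • x + β • y with hm
    have hmB : m ∈ ball c r := hconv hx hy hα hβ hαβ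
    set D := ‖x - y‖ with hD
    have hβ' : β = 1 - α := by linarith
    have exm : x - m = (β : ℂ) * (x - y) := by
      rw [hm, hβ']; simp only [Complex.real_smul]; push_cast; ring
    have eym : y - m = -(α : ℂ) * (x - y) := by
      rw [hm, hβ']; simp only [Complex.real_smul]; push_cast; ring
    have nx : ‖x - m‖ = β * D := by rw [exm, norm_mul, Complex.norm_of_nonneg hβ]
    have ny : ‖y - m‖ = α * D := by
      rw [eym, norm_mul, norm_neg, Complex.norm_of_nonneg hα]
    have hquad : ∀ {f : ℂ → ℂ}, DifferentiableOn ℂ f (ball c r) →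
        (∀ z ∈ ball c r, ‖deriv (deriv f) z‖ ≤ L) →
        ‖(α : ℂ) * f x + (β : ℂ) * f y - f m‖ ≤ L * (α * β * D ^ 2) := by
      intro f hf hb
      have h1 := htaylor hf hb m hmB x hx
      have h2 := htaylor hf hb m hmB y hy
      rw [nx] at h1
      rw [ny] at h2
      have e : (α : ℂ) * f x + (β : ℂ) * f y - f m =
          (α : ℂ) * (f x - f m - deriv f m * (x - m)) +
            (β : ℂ) * (f y - f m - deriv f m * (y - m)) := by
        rw [exm, eym, hβ']; push_cast; ring
      rw [e]
      refine (norm_add_le _ _).trans ?_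
      rw [norm_mul, norm_mul, Complex.norm_of_nonneg hα, Complex.norm_of_nonneg hβ]
      calc _ ≤ α * (L * (β * D) * (β * D)) + β * (L * (α * D) * (α * D)) := by gcongr
        _ = L * (α * β * D ^ 2) * (α + β) := by ring
        _ = _ := by rw [hαβ, mul_one]
    have hF : ‖α • harm φ ψ x + β • harm φ ψ y - harm φ ψ m‖ ≤ 2 * (L * (α * β * D ^ 2)) := by
      have e : α • harm φ ψ x + β • harm φ ψ y - harm φ ψ m =
          ((α : ℂ) * φ x + (β : ℂ) * φ y - φ m) +
            conj ((α : ℂ) * ψ x + (β : ℂ) * ψ y - ψ m) := by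
        simp only [harm, Complex.real_smul, map_sub, map_add, map_mul, Complex.conj_ofReal]; ring
      rw [e]
      refine (norm_add_le _ _).trans ?_
      rw [Complex.norm_conj]
      linarith [hquad hφ hφ2, hquad hψ hψ2]
    -- Uniform convexity of the disk leaves room for a ball of radius `ε` about `m`. Its image
    -- covers radius `7 / 8 * ε` about the image of `m`, while the convex combination of images is
    -- off by at most `4 * L * r * ε ≤ ε / 4`.
    set ε := α * β * D ^ 2 / (2 * r) with hε
    have hε0 : 0 ≤ ε := by positivity
    have hgeom : ‖m - c‖ ^ 2 = α * ‖x - c‖ ^ 2 + β * ‖y - c‖ ^ 2 - α * β * D ^ 2 := by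
      rw [hD, hm, hβ']
      simp only [← Complex.normSq_eq_norm_sq, Complex.normSq_apply, Complex.real_smul]
      simp
      ring
    have hxr : ‖x - c‖ < r := by simpa [dist_eq_norm] using hx
    have hyr : ‖y - c‖ < r := by simpa [dist_eq_norm] using hy
    have hmr : ‖m - c‖ < r := by simpa [dist_eq_norm] using hmB
    have hlt : ‖m - c‖ ^ 2 + α * β * D ^ 2 < r ^ 2 := by
      have h1 : ‖x - c‖ ^ 2 < r ^ 2 := by gcongr
      have h2 : ‖y - c‖ ^ 2 < r ^ 2 := by gcongr
      rcases hα.eq_or_lt with h | h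
      · have : β = 1 := by linarith
        rw [hgeom, ← h, this]; linarith
      · have : α * ‖x - c‖ ^ 2 < α * r ^ 2 := by gcongr
        have : β * ‖y - c‖ ^ 2 ≤ β * r ^ 2 := by gcongr
        have : α * r ^ 2 + β * r ^ 2 = r ^ 2 := by rw [← add_mul, hαβ, one_mul]
        linarith
    have hεr : ‖m - c‖ + ε < r := by
      have h1 : ε * (2 * r) = α * β * D ^ 2 := by rw [hε]; field_simp
      nlinarith [norm_nonneg (m - c)]
    have hsub : closedBall m ε ⊆ ball c r :=
      closedBall_subset_ball' (by rw [dist_eq_norm]; linarith)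
    have hcov := closedBall_subset_image (F := harm φ ψ) (b := m) (ε := ε) (c := 1 / 8)
      (by norm_num) hε0 fun x hx y hy => hlip x (hsub hx) y (hsub hy)
    refine image_mono hsub (hcov ?_)
    rw [mem_closedBall, dist_eq_norm]
    refine hF.trans ?_
    have h1 : α * β * D ^ 2 = 2 * (r * ε) := by rw [hε]; field_simp
    rw [h1]
    nlinarith

/-- A harmonic mapping close to `exp` is not injective. -/
lemma exists_harm_eq_of_near_exp {Φ Ψ : ℂ → ℂ} {Φ' Ψ' : ℂ → ℂ}
    (hΦ : ∀ z ∈ ball (0 : ℂ) 8, HasDerivAt Φ (Φ' z) z)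
    (hΨ : ∀ z ∈ ball (0 : ℂ) 8, HasDerivAt Ψ (Ψ' z) z)
    (hΦ' : ∀ z ∈ ball (0 : ℂ) 8, ‖Φ' z - Complex.exp z‖ ≤ 1 / 512)
    (hΨ' : ∀ z ∈ ball (0 : ℂ) 8, ‖Ψ' z‖ ≤ 1 / 512) :
    ∃ z ∈ ball (0 : ℂ) 8, z ≠ 0 ∧ harm Φ Ψ z = harm Φ Ψ 0 := by
  have hpi := Real.pi_lt_d2
  have hpi0 := Real.pi_gt_three
  set b : ℂ := 2 * Real.pi * Complex.I with hb
  have hbn : ‖b‖ = 2 * Real.pi := by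
    rw [hb]; simp [abs_of_pos Real.pi_pos]
  have hsub : closedBall b (1 / 8) ⊆ ball 0 8 :=
    closedBall_subset_ball' (by rw [dist_zero_right, hbn]; linarith)
  have hconv := convex_ball (0 : ℂ) 8
  have h0 : (0 : ℂ) ∈ ball (0 : ℂ) 8 := mem_ball_self (by norm_num)
  have hbB : b ∈ ball (0 : ℂ) 8 := hsub (mem_closedBall_self (by norm_num))
  have hlip : ∀ x ∈ ball (0 : ℂ) 8, ∀ y ∈ ball (0 : ℂ) 8,
      ‖harm Φ Ψ x - harm Φ Ψ y - (Complex.exp x - Complex.exp y)‖ ≤ 1 / 256 * ‖x - y‖ := by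
    intro x hx y hy
    have h1 := norm_sub_le_of_hasDerivAt (f := fun z => Φ z - Complex.exp z) hconv
      (fun z hz => (hΦ z hz).sub (Complex.hasDerivAt_exp z)) hΦ' hy hx
    have h2 := norm_sub_le_of_hasDerivAt hconv hΨ hΨ' hy hx
    have e : harm Φ Ψ x - harm Φ Ψ y - (Complex.exp x - Complex.exp y) =
        (Φ x - Complex.exp x - (Φ y - Complex.exp y)) + conj (Ψ x - Ψ y) := by
      simp only [harm, map_sub]; ring
    rw [e]
    refine (norm_add_le _ _).trans ?_
    rw [Complex.norm_conj]
    linarith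
  have hexpb : Complex.exp b = 1 := Complex.exp_two_pi_mul_I
  have hexp : ∀ x ∈ closedBall b (1 / 8), ∀ y ∈ closedBall b (1 / 8),
      ‖Complex.exp x - Complex.exp y - (x - y)‖ ≤ 1 / 4 * ‖x - y‖ := by
    intro x hx y hy
    have h1 := norm_sub_le_of_hasDerivAt (f := fun z => Complex.exp z - z)
      (f' := fun z => Complex.exp z - 1) (C := 1 / 4) (convex_closedBall b (1 / 8))
      (fun z hz => (Complex.hasDerivAt_exp z).sub (hasDerivAt_id z)) (fun z hz => by
        have hz' : ‖z - b‖ ≤ 1 / 8 := by simpa [dist_eq_norm] using hz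
        have e : Complex.exp z = Complex.exp (z - b) := by rw [Complex.exp_sub, hexpb, div_one]
        rw [e]
        have := Complex.norm_exp_sub_one_le (x := z - b) (by linarith)
        linarith) hy hx
    refine le_trans (le_of_eq ?_) h1
    congr 1; ring
  -- Near `b = 2πi` the map is close to a translation, so it covers radius `1 / 16` about its value
  -- at `b`. Its value at `0` is within `2π / 256` of that, hence is taken again near `b`.
  have hcov := closedBall_subset_image (F := harm Φ Ψ) (b := b) (ε := 1 / 8) (c := 1 / 2)
    (by norm_num) (by norm_num) fun x hx y hy => by
      have h1 := hlip x (hsub hx) y (hsub hy)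
      have h2 := hexp x hx y hy
      have e : harm Φ Ψ x - harm Φ Ψ y - (x - y) =
          (harm Φ Ψ x - harm Φ Ψ y - (Complex.exp x - Complex.exp y)) +
            (Complex.exp x - Complex.exp y - (x - y)) := by ring
      rw [e]
      refine (norm_add_le _ _).trans ?_
      nlinarith [norm_nonneg (x - y)]
  obtain ⟨z, hz, hz0⟩ := hcov (show harm Φ Ψ 0 ∈ _ by
    have := hlip 0 h0 b hbB
    rw [hexpb, Complex.exp_zero, sub_self, sub_zero, zero_sub, norm_neg, hbn] at this
    rw [mem_closedBall, dist_eq_norm]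
    linarith)
  refine ⟨z, hsub hz, ?_, hz0⟩
  rintro rfl
  rw [mem_closedBall, dist_zero_left, hbn] at hz
  linarith

/-! ### A Becker-type univalence criterion. -/

lemma norm_exp_sub_one_le_exp_norm_sub_one (z : ℂ) :
    ‖Complex.exp z - 1‖ ≤ Real.exp ‖z‖ - 1 := by
  simpa using Complex.norm_exp_sub_sum_le_exp_norm_sub_sum z 1

/-- If `log F'` has small Bloch norm, then `F` is close to its linear approximation at `w` along
segments ending at `w`. -/
lemma norm_sub_sub_le_of_small_bloch {F L L' : ℂ → ℂ}
    (hF : ∀ z ∈ unitDisk, HasDerivAt F (Complex.exp (L z)) z)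
    (hL : ∀ z ∈ unitDisk, HasDerivAt L (L' z) z)
    (hb : ∀ z ∈ unitDisk, (1 - ‖z‖) * ‖L' z‖ ≤ 1 / 8) {z w : ℂ} {δ : ℝ}
    (hz : z ∈ unitDisk) (hw : w ∈ unitDisk) (hδ : 0 < δ) (hzw : ‖z - w‖ ≤ δ)
    (hwδ : δ / 2 ≤ 1 - ‖w‖) :
    ‖F z - F w - Complex.exp (L w) * (z - w)‖ ≤ ‖Complex.exp (L w)‖ * δ / 3 := by
  set γ : ℝ → ℂ := fun x => w + x * (z - w) with hγ
  have hγd : ∀ x, HasDerivAt γ (z - w) x := fun x => by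
    exact (((Complex.ofRealCLM.hasDerivAt (x := x)).mul_const (z - w)).const_add w).congr_deriv
      (by simp)
  have hγn : ∀ x ∈ Icc (0 : ℝ) 1, ‖γ x‖ ≤ (1 - x) * ‖w‖ + x * ‖z‖ := by
    intro x hx
    have : γ x = ((1 - x : ℝ) : ℂ) * w + (x : ℂ) * z := by simp only [hγ]; push_cast; ring
    rw [this]
    refine (norm_add_le _ _).trans ?_
    rw [norm_mul, norm_mul, Complex.norm_of_nonneg hx.1, Complex.norm_of_nonneg (by linarith [hx.2])]
  have hz1 := mem_unitDisk.1 hz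
  have hw1 := mem_unitDisk.1 hw
  have hγD : ∀ x ∈ Icc (0 : ℝ) 1, γ x ∈ unitDisk := by
    intro x hx
    have := hγn x hx
    rw [mem_unitDisk]
    rcases hx.1.eq_or_lt with h | h
    · rw [← h] at this ⊢
      linarith
    · nlinarith [hx.2]
  have hγlow : ∀ x ∈ Icc (0 : ℝ) 1, (1 - x) * (δ / 2) ≤ 1 - ‖γ x‖ := by
    intro x hx
    have := hγn x hx
    nlinarith [hx.1, hx.2]
  -- Along the segment the Bloch bound gives `|(L ∘ γ)'| ≤ (1 / 8) * δ / ((1 - x) * δ / 2) = 1 /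
  -- (4(1 - x))`.
  have hlog : ∀ x ∈ Ico (0 : ℝ) 1, ‖L (γ x) - L w‖ ≤ -(1 / 4) * Real.log (1 - x) := by
    intro b hb1
    have hder : ∀ x ∈ Icc (0 : ℝ) b,
        HasDerivAt (fun x => L (γ x) - L w) (L' (γ x) * (z - w)) x := fun x hx =>
      ((hL _ (hγD x ⟨hx.1, hx.2.trans hb1.2.le⟩)).comp x (hγd x)).sub_const _
    have hB : ∀ x ∈ Icc (0 : ℝ) b,
        HasDerivAt (fun x => -(1 / 4) * Real.log (1 - x)) (1 / 4 * (1 - x)⁻¹) x := by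
      intro x hx
      have h1x : 1 - x ≠ 0 := by linarith [hx.2, hb1.2]
      exact ((((hasDerivAt_id x).const_sub 1).log h1x).const_mul (-(1 / 4))).congr_deriv
        (by simp; ring)
    refine image_norm_le_of_norm_deriv_right_le_deriv_boundary'
      (fun x hx => (hder x hx).continuousAt.continuousWithinAt)
      (fun x hx => (hder x ⟨hx.1, hx.2.le⟩).hasDerivWithinAt) (by simp [hγ])
      (fun x hx => (hB x hx).continuousAt.continuousWithinAt)
      (fun x hx => (hB x ⟨hx.1, hx.2.le⟩).hasDerivWithinAt) ?_ (right_mem_Icc.2 hb1.1)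
    intro x hx
    have hx1 : x < 1 := hx.2.trans hb1.2
    have hxI : x ∈ Icc (0 : ℝ) 1 := ⟨hx.1, hx1.le⟩
    have h1 := hb _ (hγD x hxI)
    have h2 := mul_le_mul_of_nonneg_right (hγlow x hxI) (norm_nonneg (L' (γ x)))
    have h1x : 0 < 1 - x := by linarith
    rw [norm_mul, ← div_eq_mul_inv, le_div_iff₀ h1x]
    have h3 : ‖L' (γ x)‖ * ‖z - w‖ ≤ ‖L' (γ x)‖ * δ := by gcongr
    nlinarith
  have hexp : ∀ x ∈ Ico (0 : ℝ) 1, ‖Complex.exp (L (γ x)) - Complex.exp (L w)‖ ≤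
      ‖Complex.exp (L w)‖ * ((1 - x) ^ (-(1 / 4) : ℝ) - 1) := by
    intro x hx
    have h1x : 0 < 1 - x := by linarith [hx.2]
    have e : Complex.exp (L (γ x)) - Complex.exp (L w) =
        Complex.exp (L w) * (Complex.exp (L (γ x) - L w) - 1) := by
      rw [mul_sub, ← Complex.exp_add]; simp
    rw [e, norm_mul]
    gcongr
    refine (norm_exp_sub_one_le_exp_norm_sub_one _).trans ?_
    rw [Real.rpow_def_of_pos h1x]
    gcongr
    linarith [hlog x hx]
  set E := ‖Complex.exp (L w)‖ with hE
  have hder : ∀ x ∈ Icc (0 : ℝ) 1,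
      HasDerivAt (fun x => F (γ x) - F w - Complex.exp (L w) * (γ x - w))
        ((Complex.exp (L (γ x)) - Complex.exp (L w)) * (z - w)) x := fun x hx =>
    ((((hF _ (hγD x hx)).comp x (hγd x)).sub_const _).sub
      (((hγd x).sub_const w).const_mul _)).congr_deriv (by ring)
  -- The majorant `(1 - x)^(-1/4) - 1` blows up at `1` but has integral `1 / 3`, so the endpoint `z`
  -- may be arbitrarily near the circle.
  have hB : ∀ x ∈ Ico (0 : ℝ) 1,
      HasDerivAt (fun x : ℝ => E * δ * (4 / 3 * (1 - (1 - x) ^ (3 / 4 : ℝ)) - x))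
        (E * δ * ((1 - x) ^ (-(1 / 4) : ℝ) - 1)) x := by
    intro x hx
    have h1x : 1 - x ≠ 0 := by linarith [hx.2]
    have h1 := ((hasDerivAt_id x).const_sub 1).rpow_const (p := 3 / 4) (Or.inl h1x)
    refine ((((h1.const_sub 1).const_mul (4 / 3)).sub (hasDerivAt_id x)).const_mul
      (E * δ)).congr_deriv ?_
    rw [show (3 / 4 - 1 : ℝ) = -(1 / 4) by norm_num]
    simp only [id]
    ring
  have key := image_norm_le_of_norm_deriv_right_le_deriv_boundary'
    (f := fun x => F (γ x) - F w - Complex.exp (L w) * (γ x - w))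
    (B := fun x : ℝ => E * δ * (4 / 3 * (1 - (1 - x) ^ (3 / 4 : ℝ)) - x))
    (fun x hx => (hder x hx).continuousAt.continuousWithinAt)
    (fun x hx => (hder x ⟨hx.1, hx.2.le⟩).hasDerivWithinAt) (by simp [hγ])
    (Continuous.continuousOn (by
      have : Continuous fun x : ℝ => (1 - x) ^ (3 / 4 : ℝ) :=
        (continuous_const.sub continuous_id).rpow_const fun _ => Or.inr (by norm_num)
      fun_prop))
    (fun x hx => (hB x hx).hasDerivWithinAt)
    (fun x hx => by
      have h0 : 0 ≤ E * ((1 - x) ^ (-(1 / 4) : ℝ) - 1) := (norm_nonneg _).trans (hexp x hx)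
      rw [norm_mul]
      calc _ ≤ E * ((1 - x) ^ (-(1 / 4) : ℝ) - 1) * δ :=
            mul_le_mul (hexp x hx) hzw (norm_nonneg _) h0
        _ = _ := by ring)
    (right_mem_Icc.2 zero_le_one)
  have h1 : γ 1 = z := by simp [hγ]
  simp only [h1] at key
  refine key.trans (le_of_eq ?_)
  rw [sub_self, Real.zero_rpow (by norm_num)]
  ring

/-- A weak form of Becker's univalence criterion. -/
lemma injOn_of_small_bloch {F L L' : ℂ → ℂ}
    (hF : ∀ z ∈ unitDisk, HasDerivAt F (Complex.exp (L z)) z)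
    (hL : ∀ z ∈ unitDisk, HasDerivAt L (L' z) z)
    (hb : ∀ z ∈ unitDisk, (1 - ‖z‖) * ‖L' z‖ ≤ 1 / 8) : InjOn F unitDisk := by
  intro x hx y hy hxy
  by_contra hne
  set δ := ‖x - y‖ with hδ
  have hδ0 : 0 < δ := norm_pos_iff.2 (sub_ne_zero.2 hne)
  have hx1 := mem_unitDisk.1 hx
  have hy1 := mem_unitDisk.1 hy
  have hδ2 : δ ≤ 2 := by linarith [norm_sub_le x y]
  set m := (x + y) / 2 with hm
  -- The midpoint pulled inward: `w` is within `δ` of both `x` and `y` and at least `δ / 2` from the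
  -- circle. If `F x = F y`, subtracting the two linear approximations at `w` gives `δ ≤ 2δ / 3`.
  set w : ℂ := ((1 - δ / 2 : ℝ) : ℂ) * m with hw
  have hmn : ‖m‖ ≤ 1 := by
    rw [hm, norm_div, Complex.norm_ofNat]
    linarith [norm_add_le x y]
  have hwn : ‖w‖ ≤ 1 - δ / 2 := by
    rw [hw, norm_mul, Complex.norm_of_nonneg (by linarith)]
    nlinarith
  have hwD : w ∈ unitDisk := mem_unitDisk.2 (by linarith)
  have hmw : ‖m - w‖ ≤ δ / 2 := by
    have : m - w = ((δ / 2 : ℝ) : ℂ) * m := by rw [hw]; push_cast; ring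
    rw [this, norm_mul, Complex.norm_of_nonneg (by linarith)]
    nlinarith
  have hxw : ‖x - w‖ ≤ δ := by
    have e : x - w = (x - y) / 2 + (m - w) := by rw [hm]; ring
    rw [e]
    refine (norm_add_le _ _).trans ?_
    rw [norm_div, Complex.norm_ofNat]; linarith
  have hyw : ‖y - w‖ ≤ δ := by
    have e : y - w = -((x - y) / 2) + (m - w) := by rw [hm]; ring
    rw [e]
    refine (norm_add_le _ _).trans ?_
    rw [norm_neg, norm_div, Complex.norm_ofNat]; linarith
  have h1 := norm_sub_sub_le_of_small_bloch hF hL hb hx hwD hδ0 hxw (by linarith)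
  have h2 := norm_sub_sub_le_of_small_bloch hF hL hb hy hwD hδ0 hyw (by linarith)
  have hE : 0 < ‖Complex.exp (L w)‖ := norm_pos_iff.2 (Complex.exp_ne_zero _)
  have e : Complex.exp (L w) * (x - y) = (F y - F w - Complex.exp (L w) * (y - w)) -
      (F x - F w - Complex.exp (L w) * (x - w)) := by rw [hxy]; ring
  have h3 := congrArg norm e
  rw [norm_mul, ← hδ] at h3
  have h4 := norm_sub_le (F y - F w - Complex.exp (L w) * (y - w))
      (F x - F w - Complex.exp (L w) * (x - w))
  have := mul_pos hE hδ0
  linarith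

/-! ### Bounded pre-Schwarzian and uniform local convexity or univalence. -/

lemma half_le_norm_one_add {a t : ℂ} (ha : ‖a‖ ≤ 1) (ht : ‖t‖ ≤ 1 / 2) :
    1 / 2 ≤ ‖1 + a * t‖ := by
  have h1 := norm_sub_norm_le (1 : ℂ) (-(a * t))
  rw [sub_neg_eq_add, norm_neg, norm_one, norm_mul] at h1
  nlinarith [norm_nonneg a, norm_nonneg t]

namespace IsSensePreservingHarmonic

variable {h g : ℂ → ℂ}

/-- Composition with a real linear automorphism makes a sense-preserving harmonic mapping conformal
to first order at a given point. -/
lemma exists_affine_normalization (hf : IsSensePreservingHarmonic h g) {c : ℂ}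
    (hc : c ∈ unitDisk) :
    ∃ (φ ψ : ℂ → ℂ) (A : ℂ →ₗ[ℝ] ℂ) (τ : ℂ → ℂ) (a : ℂ), Function.Injective A ∧
      (∀ z, harm φ ψ z = A (harm h g z)) ∧
      DifferentiableOn ℂ φ unitDisk ∧ DifferentiableOn ℂ ψ unitDisk ∧
      ‖a‖ ≤ 1 ∧ τ c = 0 ∧
      (∀ d, d ≤ 1 - ‖c‖ → ∀ z ∈ ball c d, ‖τ z‖ ≤ ‖z - c‖ / d) ∧
      (∀ z ∈ unitDisk, deriv φ z * (1 + a * τ z) = deriv h z / deriv h c) ∧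
      ∀ z ∈ unitDisk, ‖deriv ψ z‖ = ‖τ z‖ * ‖deriv φ z‖ := by
  set ω := dilatation h g with hω
  set b := ω c with hb
  have hb1 : ‖b‖ < 1 := hf.norm_dilatation_lt c hc
  set k : ℝ := 1 - ‖b‖ ^ 2 with hk
  have hk0 : 0 < k := one_sub_sq_pos hf.norm_dilatation_lt hc
  -- The map `w ↦ μ⁻¹ (w - conj b * conj w)` kills the co-analytic derivative at `c`; this `μ` makes
  -- the analytic one equal to `1`. The new dilatation has modulus `|τ|`, with `τ` the Möbius image
  -- of `ω` vanishing at `c`.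
  set μ : ℂ := deriv h c * k with hμ
  have hhc := hf.deriv_ne_zero hc
  have hkC : (k : ℂ) ≠ 0 := Complex.ofReal_ne_zero.2 hk0.ne'
  have hμ0 : μ ≠ 0 := mul_ne_zero hhc hkC
  have dh : ∀ z ∈ unitDisk, HasDerivAt h (deriv h z) z := fun z hz =>
    (hf.analytic_h.differentiableAt (isOpen_unitDisk.mem_nhds hz)).hasDerivAt
  have dg : ∀ z ∈ unitDisk, HasDerivAt g (ω z * deriv h z) z := fun z hz => by
    rw [hω, ← hf.deriv_g_eq hz]
    exact (hf.analytic_g.differentiableAt (isOpen_unitDisk.mem_nhds hz)).hasDerivAt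
  have dφ : ∀ z ∈ unitDisk, HasDerivAt (fun z => μ⁻¹ * (h z - conj b * g z))
      (μ⁻¹ * (deriv h z * (1 - conj b * ω z))) z := fun z hz =>
    (((dh z hz).sub ((dg z hz).const_mul (conj b))).const_mul μ⁻¹).congr_deriv (by ring)
  have dψ : ∀ z ∈ unitDisk, HasDerivAt (fun z => conj μ⁻¹ * (g z - b * h z))
      (conj μ⁻¹ * (deriv h z * (ω z - b))) z := fun z hz =>
    (((dg z hz).sub ((dh z hz).const_mul b)).const_mul (conj μ⁻¹)).congr_deriv (by ring)
  refine ⟨fun z => μ⁻¹ * (h z - conj b * g z), fun z => conj μ⁻¹ * (g z - b * h z),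
    { toFun := fun w => μ⁻¹ * (w - conj b * conj w)
      map_add' := fun x y => by rw [map_add]; ring
      map_smul' := fun r x => by
        simp only [Complex.real_smul, map_mul, Complex.conj_ofReal, RingHom.id_apply]; ring },
    fun z => (ω z - b) / (1 - conj b * ω z), conj b, ?_, ?_, ?_, ?_, ?_, ?_, ?_, ?_, ?_⟩
  · refine (injective_iff_map_eq_zero _).2 fun w hw => ?_
    have h1 : w - conj b * conj w = 0 := by simpa [hμ0] using hw
    have h2 := congrArg norm (sub_eq_zero.1 h1)
    rw [norm_mul, Complex.norm_conj, Complex.norm_conj] at h2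
    by_contra hne
    have := norm_pos_iff.2 hne
    nlinarith
  · intro z
    simp only [harm, LinearMap.coe_mk, AddHom.coe_mk, map_mul, map_sub, map_add, Complex.conj_conj]
    ring
  · exact fun z hz => (dφ z hz).differentiableAt.differentiableWithinAt
  · exact fun z hz => (dψ z hz).differentiableAt.differentiableWithinAt
  · rw [Complex.norm_conj]; exact hb1.le
  · simp [hb]
  · intro d hd z hz
    exact norm_mobius_le hf.differentiableOn_dilatation hf.norm_dilatation_lt hc hd hz
  · intro z hz
    rw [(dφ z hz).deriv]
    have h1 := one_sub_mul_one_add_mobius hb1 (hf.norm_dilatation_lt z hz)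
    rw [← hk, ← hω] at h1
    calc _ = μ⁻¹ * deriv h z * ((1 - conj b * ω z) *
          (1 + conj b * ((ω z - b) / (1 - conj b * ω z)))) := by ring
      _ = _ := by rw [h1, hμ]; field_simp
  · intro z hz
    have h0 := one_sub_conj_mul_ne_zero hb1 (hf.norm_dilatation_lt z hz)
    rw [← hω] at h0
    rw [(dφ z hz).deriv, (dψ z hz).deriv]
    simp only [norm_mul, norm_div, Complex.norm_conj]
    rw [div_mul_eq_mul_div, eq_div_iff (norm_ne_zero_iff.2 h0)]
    ring

/-- On a ball of radius `s * d` the logarithm of `h' / h' c` stays below `1 / 2`, so the normalised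
parts have bounded derivatives and Cauchy's estimate bounds their second derivatives. Convexity of
the image survives undoing the injective real-linear map. -/
lemma ulc_of_preBdd (hf : IsSensePreservingHarmonic h g) (hp : PreBdd h) : ULC (harm h g) := by
  obtain ⟨C, hC⟩ := hp
  have hC0 : 0 ≤ C := by
    have h0 : (0 : ℂ) ∈ unitDisk := by simp [mem_unitDisk]
    have := hC 0 h0
    simp only [norm_zero] at this
    exact le_trans (by positivity) this
  set s : ℝ := 1 / (4 * (1 + C)) with hs
  have hs0 : 0 < s := by positivity
  have hsC : s * (1 + C) = 1 / 4 := by rw [hs]; field_simp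
  have hs4 : s ≤ 1 / 4 := by nlinarith
  -- The second derivatives will be at most `16 / (s * d)`; the factor `1 / 256` yields the `1 / 16`
  -- required by `convexIn_harm_ball`.
  refine ulc_of_convexIn_ball (s := s / 256) (by positivity) fun c hc r hr hrs => ?_
  have hd := one_sub_norm_pos hc
  set d := 1 - ‖c‖ with hddef
  have hsub := ball_subset_unitDisk (c := c) (d := d) le_rfl
  obtain ⟨L, hLc, hL, hLe⟩ := exists_log (c := c) (R := d) hd
    ((hf.analytic_h.deriv isOpen_unitDisk).mono hsub) fun z hz => hf.deriv_ne_zero (hsub hz)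
  obtain ⟨φ, ψ, A, τ, a, hA, hFA, hφ, hψ, ha, hτc, hτ, hφ', hψ'⟩ :=
    hf.exists_affine_normalization hc
  have hsd : ball c (s * d) ⊆ ball c (d / 2) := ball_subset_ball (by nlinarith)
  have hsd' : ball c (s * d) ⊆ ball c d := hsd.trans (ball_subset_ball (by linarith))
  have hsdD := hsd'.trans hsub
  have hLb : ∀ z ∈ ball c (s * d), ‖L z‖ ≤ 1 / 2 := by
    intro z hz
    have h1 := norm_sub_le_of_hasDerivAt (C := 2 * C / d) (convex_ball c (s * d))
      (fun z hz => hL z (hsd' hz)) (fun z hz => by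
        have hzn : ‖z - c‖ < d / 2 := by simpa [dist_eq_norm] using hsd hz
        have h2 : d / 2 ≤ 1 - ‖z‖ := by
          have := norm_sub_norm_le z c
          linarith
        have h3 := hC z (hsdD hz)
        have h4 := mul_le_mul_of_nonneg_right (h2.trans (le_one_sub_sq (hsdD hz)))
          (norm_nonneg (deriv (deriv h) z / deriv h z))
        rw [le_div_iff₀ hd]
        linarith) (mem_ball_self (by positivity)) hz
    have hzn : ‖z - c‖ ≤ s * d := (by simpa [dist_eq_norm] using hz : ‖z - c‖ < s * d).le
    rw [hLc, sub_zero] at h1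
    refine h1.trans ((mul_le_mul_of_nonneg_left hzn (by positivity)).trans ?_)
    have : 2 * C / d * (s * d) = 2 * (s * C) := by field_simp
    rw [this]; nlinarith
  have hτb : ∀ z ∈ ball c (s * d), ‖τ z‖ ≤ 1 / 2 := by
    intro z hz
    have hzn : ‖z - c‖ < d / 2 := by simpa [dist_eq_norm] using hsd hz
    refine (hτ d le_rfl z (hsd' hz)).trans ?_
    rw [div_le_iff₀ hd]; linarith
  have hφb : ∀ z ∈ ball c (s * d), ‖deriv φ z‖ ≤ 4 := by
    intro z hz
    have h1 := hφ' z (hsdD hz)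
    rw [hLe z (hsd' hz), mul_div_cancel_left₀ _ (hf.deriv_ne_zero hc)] at h1
    have h2 := congrArg norm h1
    rw [norm_mul] at h2
    have h3 := half_le_norm_one_add ha (hτb z hz)
    have h4 : ‖Complex.exp (L z)‖ ≤ 2 := by
      have h5 := Complex.norm_exp_sub_one_le (x := L z) ((hLb z hz).trans (by norm_num))
      have h6 := norm_sub_norm_le (Complex.exp (L z)) 1
      have h7 := hLb z hz
      rw [norm_one] at h6
      linarith
    nlinarith [norm_nonneg (deriv φ z)]
  have hψb : ∀ z ∈ ball c (s * d), ‖deriv ψ z‖ ≤ 4 := by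
    intro z hz
    rw [hψ' z (hsdD hz)]
    nlinarith [hφb z hz, hτb z hz, norm_nonneg (τ z), norm_nonneg (deriv φ z)]
  have hcauchy : ∀ {f : ℂ → ℂ}, DifferentiableOn ℂ f unitDisk →
      (∀ z ∈ ball c (s * d), ‖deriv f z‖ ≤ 4) →
      ∀ z ∈ ball c r, ‖deriv (deriv f) z‖ ≤ 4 / (s * d / 4) := by
    intro f hfd hb z hz
    have hzc : closedBall z (s * d / 4) ⊆ ball c (s * d) :=
      closedBall_subset_ball' (by
        have : dist z c < r := hz
        nlinarith [mul_pos hs0 hd])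
    exact Complex.norm_deriv_le_of_forall_mem_sphere_norm_le (by positivity)
      (((hfd.deriv isOpen_unitDisk).mono (hzc.trans hsdD)).diffContOnCl_ball subset_rfl)
      fun w hw => hb w (hzc (sphere_subset_closedBall hw))
  have hrD : ball c r ⊆ unitDisk :=
    (ball_subset_ball (by nlinarith [mul_pos hs0 hd])).trans hsdD
  have hφc : deriv φ c = 1 := by
    have := hφ' c hc
    rwa [hτc, mul_zero, add_zero, mul_one, div_self (hf.deriv_ne_zero hc)] at this
  have hψc : deriv ψ c = 0 := by
    have := hψ' c hc
    rwa [hτc, norm_zero, zero_mul, norm_eq_zero] at this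
  have hconv := convexIn_harm_ball (L := 4 / (s * d / 4)) hr (hφ.mono hrD) (hψ.mono hrD) hφc hψc
    (hcauchy hφ hφb) (hcauchy hψ hψb) (by
      rw [div_mul_eq_mul_div, div_le_iff₀ (by positivity)]
      linarith)
  have hFA' : harm φ ψ = A ∘ harm h g := funext hFA
  refine ⟨fun x hx y hy hxy => hconv.1 hx hy (by rw [hFA, hFA, hxy]), ?_⟩
  have := hconv.2.linear_preimage A
  rwa [hFA', image_comp, preimage_image_eq _ hA] at this

/-- Where the pre-Schwarzian is large, the mapping looks like an exponential and is not
injective. -/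
lemma not_injOn_of_large_pre (hf : IsSensePreservingHarmonic h g) {c : ℂ} {d : ℝ} (hd : 0 < d)
    (hc : c ∈ unitDisk) (hdc : d ≤ 1 - ‖c‖)
    (hbound : ∀ z ∈ ball c d, ‖deriv (deriv h) z / deriv h z‖ ≤
      2 * ‖deriv (deriv h) c / deriv h c‖)
    (hlarge : 10 ^ 6 * Real.exp 8 < d * ‖deriv (deriv h) c / deriv h c‖) :
    ¬ InjOn (harm h g) (ball c d) := by
  intro hinj
  set P : ℂ → ℂ := fun z => deriv (deriv h) z / deriv h z with hP
  set p := P c with hp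
  set K := Real.exp 8 with hK
  have hK1 : 1 ≤ K := Real.one_le_exp (by norm_num)
  set N := d * ‖p‖ with hN
  have hlarge : 10 ^ 6 * K < N := hlarge
  have hN0 : 0 < N := by linarith
  have hpn : 0 < ‖p‖ := by
    rcases (norm_nonneg p).eq_or_lt with h | h
    · rw [hN, ← h, mul_zero] at hN0; exact absurd hN0 (lt_irrefl _)
    · exact h
  have hp0 : p ≠ 0 := norm_pos_iff.1 hpn
  have hsub := ball_subset_unitDisk hdc
  obtain ⟨L, hLc, hL, hLe⟩ := exists_log (c := c) (R := d) hd
    ((hf.analytic_h.deriv isOpen_unitDisk).mono hsub) fun z hz => hf.deriv_ne_zero (hsub hz)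
  obtain ⟨φ, ψ, A, τ, a, hA, hFA, hφ, hψ, ha, hτc, hτ, hφ', hψ'⟩ :=
    hf.exists_affine_normalization hc
  -- The Schwarz lemma for `P - p`, so that `P` is nearly constant at the scale `8 / |p|`, much
  -- smaller than `d`. The `8` exceeds `2π`: in the variable `ζ = p(z - c)` the ball contains a
  -- period of `exp`.
  have hPlip : ∀ z ∈ ball c d, ‖P z - p‖ ≤ 3 * ‖p‖ / d * ‖z - c‖ := by
    intro z hz
    have := Complex.dist_le_div_mul_dist_of_mapsTo_ball (R₂ := 3 * ‖p‖)
      (hf.differentiableOn_pre.mono hsub) (fun w hw => by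
        rw [mem_closedBall, dist_eq_norm]
        have h1 := norm_sub_le (P w) p
        have h2 : ‖P w‖ ≤ 2 * ‖p‖ := hbound w hw
        exact h1.trans (by linarith)) hz
    simpa only [dist_eq_norm] using this
  have h8d : 8 / ‖p‖ < d := by
    rw [div_lt_iff₀ hpn]
    linarith
  have h8sub : ball c (8 / ‖p‖) ⊆ ball c d := ball_subset_ball h8d.le
  have hLlin : ∀ z ∈ ball c (8 / ‖p‖), ‖L z - p * (z - c)‖ ≤ 192 / N := by
    intro z hz
    have h1 := norm_sub_le_of_hasDerivAt (f := fun z => L z - p * z) (f' := fun z => P z - p)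
      (C := 24 / d) (convex_ball c (8 / ‖p‖))
      (fun z hz => ((hL z (h8sub hz)).sub ((hasDerivAt_id z).const_mul p)).congr_deriv
        (by simp [hP])) (fun z hz => by
        have hzn : ‖z - c‖ ≤ 8 / ‖p‖ := (by simpa [dist_eq_norm] using hz : ‖z - c‖ < 8 / ‖p‖).le
        refine (hPlip z (h8sub hz)).trans
          ((mul_le_mul_of_nonneg_left hzn (by positivity)).trans (le_of_eq ?_))
        field_simp; norm_num) (mem_ball_self (by positivity)) hz
    have hzn : ‖z - c‖ ≤ 8 / ‖p‖ := (by simpa [dist_eq_norm] using hz : ‖z - c‖ < 8 / ‖p‖).le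
    have e : L z - p * (z - c) = L z - p * z - (L c - p * c) := by rw [hLc]; ring
    rw [e]
    refine h1.trans ((mul_le_mul_of_nonneg_left hzn (by positivity)).trans (le_of_eq ?_))
    rw [hN]; field_simp; norm_num
  have hmem : ∀ ζ ∈ ball (0 : ℂ) 8, c + ζ / p ∈ ball c (8 / ‖p‖) := by
    intro ζ hζ
    rw [mem_ball, dist_eq_norm, add_sub_cancel_left, norm_div]
    gcongr
    simpa using hζ
  have hφexp : ∀ ζ ∈ ball (0 : ℂ) 8, ‖deriv φ (c + ζ / p) - Complex.exp ζ‖ ≤ 784 * K / N ∧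
      ‖τ (c + ζ / p)‖ ≤ 8 / N := by
    intro ζ hζ
    have hz := hmem ζ hζ
    set z := c + ζ / p with hzdef
    have hzd := h8sub hz
    have hζ8 : ‖ζ‖ < 8 := by simpa using hζ
    have hzn : ‖z - c‖ ≤ 8 / ‖p‖ := (by simpa [dist_eq_norm] using hz : ‖z - c‖ < 8 / ‖p‖).le
    have hτz : ‖τ z‖ ≤ 8 / N := by
      refine (hτ d hdc z hzd).trans ?_
      calc ‖z - c‖ / d ≤ 8 / ‖p‖ / d := by gcongr
        _ = 8 / N := by rw [hN]; field_simp
    have hNbig : 8 / N ≤ 1 / 2 := by rw [div_le_iff₀ hN0]; linarith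
    have hN384 : 192 / N ≤ 1 := by rw [div_le_iff₀ hN0]; linarith
    have h1 := hφ' z (hsub hzd)
    rw [hLe z hzd, mul_div_cancel_left₀ _ (hf.deriv_ne_zero hc)] at h1
    have h2 := hLlin z hz
    have hpz : p * (z - c) = ζ := by rw [hzdef]; field_simp; ring
    rw [hpz] at h2
    have h3 := Complex.norm_exp_sub_one_le (x := L z - ζ) (h2.trans hN384)
    have h4 := half_le_norm_one_add ha (hτz.trans hNbig)
    have hE : ‖Complex.exp ζ‖ ≤ K :=
      (Complex.norm_exp_le_exp_norm ζ).trans (Real.exp_le_exp.2 hζ8.le)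
    have h5 : (deriv φ z - Complex.exp ζ) * (1 + a * τ z) =
        Complex.exp ζ * ((Complex.exp (L z - ζ) - 1) - a * τ z) := by
      rw [sub_mul, h1, mul_sub, mul_sub, ← Complex.exp_add]
      ring_nf
    have h6 : ‖(Complex.exp (L z - ζ) - 1) - a * τ z‖ ≤ 392 / N := by
      refine (norm_sub_le _ _).trans ?_
      rw [norm_mul]
      have h7 : ‖a‖ * ‖τ z‖ ≤ 1 * (8 / N) := by gcongr
      have h8 : 392 / N = 2 * (192 / N) + 8 / N := by ring
      linarith
    have h7 := congrArg norm h5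
    rw [norm_mul, norm_mul] at h7
    have h8 : ‖Complex.exp ζ‖ * ‖(Complex.exp (L z - ζ) - 1) - a * τ z‖ ≤ K * (392 / N) := by
      gcongr
    refine ⟨?_, hτz⟩
    have h9 : 784 * K / N = 2 * (K * (392 / N)) := by ring
    rw [h9]
    nlinarith [norm_nonneg (deriv φ z - Complex.exp ζ)]
  have hsmall : 784 * K / N ≤ 1 / 512 := by
    rw [div_le_div_iff₀ hN0 (by norm_num)]; linarith
  have dcomp : ∀ {f : ℂ → ℂ}, DifferentiableOn ℂ f unitDisk → ∀ ζ ∈ ball (0 : ℂ) 8,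
      HasDerivAt (fun ζ => f (c + ζ / p)) (deriv f (c + ζ / p) * (1 / p)) ζ := by
    intro f hfd ζ hζ
    have h1 := (hfd.differentiableAt
      (isOpen_unitDisk.mem_nhds (hsub (h8sub (hmem ζ hζ))))).hasDerivAt
    exact h1.comp ζ (((hasDerivAt_id ζ).div_const p).const_add c)
  -- The factor `p` on `Φ` and `conj p` on `Ψ` multiply the whole harmonic map by `p`, which
  -- compensates `dz = dζ / p`.
  obtain ⟨ζ, hζ, hζ0, hζeq⟩ := exists_harm_eq_of_near_exp
    (Φ := fun ζ => p * φ (c + ζ / p)) (Ψ := fun ζ => conj p * ψ (c + ζ / p))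
    (Φ' := fun ζ => deriv φ (c + ζ / p)) (Ψ' := fun ζ => conj p * (deriv ψ (c + ζ / p) * (1 / p)))
    (fun ζ hζ => ((dcomp hφ ζ hζ).const_mul p).congr_deriv (by field_simp))
    (fun ζ hζ => (dcomp hψ ζ hζ).const_mul (conj p))
    (fun ζ hζ => (hφexp ζ hζ).1.trans hsmall)
    (fun ζ hζ => by
      have hζ8 : ‖ζ‖ < 8 := by simpa using hζ
      have h1 := hφexp ζ hζ
      have hE : ‖Complex.exp ζ‖ ≤ K :=
        (Complex.norm_exp_le_exp_norm ζ).trans (Real.exp_le_exp.2 hζ8.le)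
      have h2 : ‖deriv φ (c + ζ / p)‖ ≤ 2 * K := by
        have := norm_sub_norm_le (deriv φ (c + ζ / p)) (Complex.exp ζ)
        linarith [h1.1.trans hsmall]
      have h3 : ‖conj p * (deriv ψ (c + ζ / p) * (1 / p))‖ = ‖deriv ψ (c + ζ / p)‖ := by
        rw [norm_mul, norm_mul, norm_div, norm_one, Complex.norm_conj]; field_simp
      rw [h3, hψ' _ (hsub (h8sub (hmem ζ hζ)))]
      calc _ ≤ 8 / N * (2 * K) := by gcongr; exact h1.2
        _ = 16 * K / N := by ring
        _ ≤ 1 / 512 := by rw [div_le_div_iff₀ hN0 (by norm_num)]; linarith)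
  have hscale : ∀ ζ, harm (fun ζ => p * φ (c + ζ / p)) (fun ζ => conj p * ψ (c + ζ / p)) ζ =
      p * A (harm h g (c + ζ / p)) := by
    intro ζ
    rw [← hFA]
    simp only [harm, map_mul, Complex.conj_conj]; ring
  rw [hscale, hscale] at hζeq
  have h1 := hA (mul_left_cancel₀ hp0 hζeq)
  have h2 := hinj (h8sub (hmem ζ hζ)) (h8sub (hmem 0 (mem_ball_self (by norm_num)))) h1
  have h3 : ζ / p = 0 := by simpa using h2
  exact hζ0 ((div_eq_zero_iff.1 h3).resolve_right hp0)

/-- A point where `P` is large need not dominate its neighbourhood. Maximising `(R - |z - c|)|P z|`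
moves it to `w` with `|P| ≤ 2|P w|` on a ball of radius `D / 2`, where `D * |P w|` is still large,
as `not_injOn_of_large_pre` requires. -/
lemma preBdd_of_ulu (hf : IsSensePreservingHarmonic h g) (hu : ULU (harm h g)) : PreBdd h := by
  obtain ⟨s, hs0, hs1, hinj⟩ := hu.exists_injOn_ball
  set N := 10 ^ 6 * Real.exp 8 with hN
  have hN0 : 0 < N := by positivity
  set P : ℂ → ℂ := fun z => deriv (deriv h) z / deriv h z with hP
  refine ⟨2 * (4 * N / s), fun c hc => ?_⟩
  have hd := one_sub_norm_pos hc
  set d := 1 - ‖c‖ with hddef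
  suffices hkey : d * ‖P c‖ ≤ 4 * N / s by
    have h1 : (1 - ‖c‖ ^ 2) * ‖P c‖ ≤ 2 * d * ‖P c‖ :=
      mul_le_mul_of_nonneg_right (one_sub_sq_le c) (norm_nonneg _)
    linarith
  rw [le_div_iff₀ hs0]
  by_contra! hcon
  set R := s * d / 2 with hR
  have hR0 : 0 < R := by positivity
  have hRd : R ≤ d / 4 := by rw [hR]; nlinarith
  have hsub : closedBall c R ⊆ unitDisk :=
    (closedBall_subset_ball (by linarith)).trans (ball_subset_unitDisk (d := d) le_rfl)
  obtain ⟨w, hw, hmax⟩ := (isCompact_closedBall c R).exists_isMaxOn ⟨c, mem_closedBall_self hR0.le⟩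
    (f := fun z => (R - ‖z - c‖) * ‖P z‖)
    ((by fun_prop : Continuous fun z : ℂ => R - ‖z - c‖).continuousOn.mul
      (hf.differentiableOn_pre.continuousOn.mono hsub).norm)
  have hmax' : ∀ z ∈ closedBall c R, (R - ‖z - c‖) * ‖P z‖ ≤ (R - ‖w - c‖) * ‖P w‖ :=
    fun z hz => hmax hz
  have h1 := hmax' c (mem_closedBall_self hR0.le)
  rw [sub_self, norm_zero, sub_zero] at h1
  have h2 : 2 * N < (R - ‖w - c‖) * ‖P w‖ := by
    have : R * ‖P c‖ = d * ‖P c‖ * s / 2 := by rw [hR]; ring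
    linarith
  set D := R - ‖w - c‖ with hD
  have hD0 : 0 < D := by
    by_contra! hneg
    have := mul_nonpos_of_nonpos_of_nonneg hneg (norm_nonneg (P w))
    linarith
  have hwD : ball w (D / 2) ⊆ closedBall c R := by
    intro z hz
    have hzw : ‖z - w‖ < D / 2 := by simpa [dist_eq_norm] using hz
    have : ‖z - c‖ ≤ ‖z - w‖ + ‖w - c‖ := by simpa using norm_add_le (z - w) (w - c)
    rw [mem_closedBall, dist_eq_norm]
    linarith
  refine hf.not_injOn_of_large_pre (c := w) (d := D / 2) (by linarith) (hsub hw) ?_ ?_ ?_ ?_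
  · have := norm_sub_norm_le w c
    linarith
  · intro z hz
    have hzw : ‖z - w‖ < D / 2 := by simpa [dist_eq_norm] using hz
    have h3 : ‖z - c‖ ≤ ‖z - w‖ + ‖w - c‖ := by simpa using norm_add_le (z - w) (w - c)
    have h4 := hmax' z (hwD hz)
    have h5 : D / 2 * ‖P z‖ ≤ (R - ‖z - c‖) * ‖P z‖ := by
      gcongr
      linarith
    have h6 : D * ‖P z‖ ≤ D * (2 * ‖P w‖) := by linarith
    exact le_of_mul_le_mul_left h6 hD0
  · change N < D / 2 * ‖P w‖
    linarith
  · refine (hinj c hc).mono (hwD.trans (closedBall_subset_ball ?_))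
    rw [hR]
    nlinarith [mul_pos hs0 hd]

/-- The equivalent conditions for a single sense-preserving harmonic mapping. -/
lemma tfae_preBdd (hf : IsSensePreservingHarmonic h g) :
    List.TFAE [PreBdd h, ULU (harm h g), ULC (harm h g), BoundedPSN h g, BoundedSN h g] := by
  tfae_have 1 → 3 := hf.ulc_of_preBdd
  tfae_have 3 → 2 := ULC.ulu
  tfae_have 2 → 1 := hf.preBdd_of_ulu
  tfae_have 4 ↔ 1 := hf.boundedPSN_iff
  tfae_have 5 ↔ 1 := hf.boundedSN_iff
  tfae_finish

/-! ### The perturbations with parameter `ε`. -/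

lemma coPart (hf : IsSensePreservingHarmonic h g) {ε : ℂ} (hε : ‖ε‖ ≤ 1) :
    IsSensePreservingHarmonic h (coPart g ε) where
  analytic_h := hf.analytic_h
  analytic_g := hf.analytic_g.const_mul _
  jacobian_pos z hz := by
    have h1 : deriv (HarmonicULU.coPart g ε) z = conj ε * deriv g z :=
      deriv_const_mul _ (hf.analytic_g.differentiableAt (isOpen_unitDisk.mem_nhds hz))
    have h2 := hf.jacobian_pos z hz
    rw [h1, norm_mul, Complex.norm_conj, mul_pow]
    have h3 : ‖ε‖ ^ 2 ≤ 1 := pow_le_one₀ (norm_nonneg _) hε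
    nlinarith [sq_nonneg ‖deriv g z‖]

lemma deriv_anaPerturb (hf : IsSensePreservingHarmonic h g) (ε : ℂ) {z : ℂ} (hz : z ∈ unitDisk) :
    deriv (anaPerturb h g ε) z = deriv h z * (1 + ε * dilatation h g z) := by
  have h1 := (hf.analytic_h.differentiableAt (isOpen_unitDisk.mem_nhds hz)).hasDerivAt
  have h2 := (hf.analytic_g.differentiableAt (isOpen_unitDisk.mem_nhds hz)).hasDerivAt
  have h3 : HasDerivAt (HarmonicULU.anaPerturb h g ε) (deriv h z + ε * deriv g z) z :=
    h1.add (h2.const_mul ε)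
  rw [h3.deriv, hf.deriv_g_eq hz]; ring

lemma one_sub_norm_dilatation_le (hf : IsSensePreservingHarmonic h g) {ε : ℂ} (hε : ‖ε‖ ≤ 1)
    {z : ℂ} (hz : z ∈ unitDisk) :
    0 < 1 - ‖dilatation h g z‖ ∧
      1 - ‖dilatation h g z‖ ≤ ‖1 + ε * dilatation h g z‖ := by
  refine ⟨by linarith [hf.norm_dilatation_lt z hz], ?_⟩
  have h1 := norm_sub_norm_le (1 : ℂ) (-(ε * dilatation h g z))
  rw [sub_neg_eq_add, norm_neg, norm_one, norm_mul] at h1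
  nlinarith [norm_nonneg (dilatation h g z)]

lemma anaPerturb (hf : IsSensePreservingHarmonic h g) {ε : ℂ} (hε : ‖ε‖ ≤ 1) :
    IsSensePreservingHarmonic (anaPerturb h g ε) 0 where
  analytic_h := hf.analytic_h.add (hf.analytic_g.const_mul _)
  analytic_g := differentiableOn_const 0
  jacobian_pos z hz := by
    obtain ⟨h1, h2⟩ := hf.one_sub_norm_dilatation_le hε hz
    have h3 : deriv (0 : ℂ → ℂ) z = 0 := deriv_const z 0
    have h4 := norm_pos_iff.2 (hf.deriv_ne_zero hz)
    have h5 := h1.trans_le h2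
    rw [hf.deriv_anaPerturb ε hz, h3, norm_mul]
    rw [norm_zero]
    linarith [pow_pos (mul_pos h4 h5) 2]

/-- The pre-Schwarzians differ by `ε ω' / (1 + ε ω)`. Even for `|ε| = 1` this is controlled, because
`|1 + ε ω| ≥ 1 - |ω|` and `(1 - |z|²)|ω'| ≤ 2(1 - |ω|²) ≤ 4(1 - |ω|)`. -/
lemma preBdd_anaPerturb_iff (hf : IsSensePreservingHarmonic h g) {ε : ℂ} (hε : ‖ε‖ ≤ 1) :
    PreBdd (HarmonicULU.anaPerturb h g ε) ↔ PreBdd h := by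
  refine exists_bound_iff_of_sub (K := 4)
    (p := fun z => deriv (deriv (HarmonicULU.anaPerturb h g ε)) z /
      deriv (HarmonicULU.anaPerturb h g ε) z)
    (q := fun z => deriv (deriv h) z / deriv h z) fun z hz => ?_
  obtain ⟨h1, h2⟩ := hf.one_sub_norm_dilatation_le hε hz
  have h3 : deriv (deriv (HarmonicULU.anaPerturb h g ε)) z =
      deriv (deriv h) z * (1 + ε * dilatation h g z) +
        deriv h z * (ε * deriv (dilatation h g) z) := by
    rw [← ((hf.hasDerivAt_deriv_h hz).mul
      (((hf.hasDerivAt_dilatation hz).const_mul ε).const_add 1)).deriv]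
    apply Filter.EventuallyEq.deriv_eq
    filter_upwards [isOpen_unitDisk.mem_nhds hz] with w hw using hf.deriv_anaPerturb ε hw
  have h0 := hf.deriv_ne_zero hz
  have h4 : 1 + ε * dilatation h g z ≠ 0 := norm_pos_iff.1 (h1.trans_le h2)
  have h5 : deriv (deriv (HarmonicULU.anaPerturb h g ε)) z /
      deriv (HarmonicULU.anaPerturb h g ε) z - deriv (deriv h) z / deriv h z =
      ε * deriv (dilatation h g) z / (1 + ε * dilatation h g z) := by
    rw [h3, hf.deriv_anaPerturb ε hz]
    field_simp
    ring
  rw [h5, norm_div, norm_mul, ← mul_div_assoc, div_le_iff₀ (h1.trans_le h2)]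
  have h6 := norm_deriv_le_of_selfMap hf.differentiableOn_dilatation hf.norm_dilatation_lt hz
  have h7 : ‖ε‖ * ((1 - ‖z‖ ^ 2) * ‖deriv (dilatation h g) z‖) ≤
      1 * (2 * (1 - ‖dilatation h g z‖ ^ 2)) :=
    mul_le_mul hε h6 (mul_nonneg ((one_sub_norm_pos hz).le.trans (le_one_sub_sq hz))
      (norm_nonneg _)) zero_le_one
  have h8 := one_sub_sq_le (dilatation h g z)
  linarith

end IsSensePreservingHarmonic

/-! ### Powers of derivatives of univalent functions. -/

lemma harm_zero (φ : ℂ → ℂ) : harm φ 0 = φ := by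
  funext z
  simp [harm]

lemma ulu_of_injOn {F : ℂ → ℂ} (hF : InjOn F unitDisk) : ULU F :=
  zero_lt_one.trans_le (le_iInf₂ fun _ _ =>
    le_sSup ⟨zero_lt_one, hF.mono fun _ hz => hz.1⟩)

/-- Here `φ'' / φ' = m F'' / F'`, and a univalent `F` is ULU, so `preBdd_of_ulu` with zero
co-analytic part applies to it. -/
lemma IsPowerOfUnivalent.preBdd {φ : ℂ → ℂ} (hφ : IsPowerOfUnivalent φ) : PreBdd φ := by
  obtain ⟨m, F, L, hm, hF, hFu, hL, hLF, hLφ⟩ := hφ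
  have hsp : IsSensePreservingHarmonic F 0 :=
    ⟨hF, differentiableOn_const 0, fun z hz => by
      have h3 : deriv (0 : ℂ → ℂ) z = 0 := deriv_const z 0
      have h4 : 0 < ‖deriv F z‖ := by
        rw [← hLF z hz]; exact norm_pos_iff.2 (Complex.exp_ne_zero _)
      rw [h3, norm_zero]
      linarith [pow_pos h4 2]⟩
  obtain ⟨C, hC⟩ := hsp.preBdd_of_ulu (by rw [harm_zero]; exact ulu_of_injOn hFu)
  refine ⟨m * C, fun z hz => ?_⟩
  have hnhds := isOpen_unitDisk.mem_nhds hz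
  have dL := (hL.differentiableAt hnhds).hasDerivAt
  have h1 : deriv (deriv F) z = Complex.exp (L z) * deriv L z := by
    rw [← dL.cexp.deriv]
    apply Filter.EventuallyEq.deriv_eq
    filter_upwards [hnhds] with w hw using (hLF w hw).symm
  have h2 : deriv (deriv φ) z = Complex.exp (m * L z) * (m * deriv L z) := by
    rw [← (dL.const_mul (m : ℂ)).cexp.deriv]
    apply Filter.EventuallyEq.deriv_eq
    filter_upwards [hnhds] with w hw using hLφ w hw
  have h3 := hC z hz
  rw [h1, ← hLF z hz, mul_div_cancel_left₀ _ (Complex.exp_ne_zero _)] at h3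
  rw [h2, hLφ z hz, mul_div_cancel_left₀ _ (Complex.exp_ne_zero _), norm_mul,
    Complex.norm_of_nonneg hm.le]
  nlinarith

/-- Dividing `log φ'` by a large `m` makes its Bloch norm small enough for `injOn_of_small_bloch`;
`F` is a primitive of the exponential of the quotient. -/
lemma isPowerOfUnivalent_of_preBdd {φ : ℂ → ℂ} (hφ : DifferentiableOn ℂ φ unitDisk)
    (h0 : ∀ z ∈ unitDisk, deriv φ z ≠ 0) (hp : PreBdd φ) : IsPowerOfUnivalent φ := by
  obtain ⟨C, hC⟩ := hp
  set m : ℝ := 8 * (|C| + 1) with hm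
  have hm0 : 0 < m := by positivity
  have hmC : (m : ℂ) ≠ 0 := Complex.ofReal_ne_zero.2 hm0.ne'
  have hz0 : (0 : ℂ) ∈ unitDisk := by simp [mem_unitDisk]
  obtain ⟨L, -, hL, hLe⟩ := exists_log (c := 0) (R := 1) one_pos (hφ.deriv isOpen_unitDisk) h0
  set M : ℂ → ℂ := fun z => (Complex.log (deriv φ 0) + L z) / m with hM
  have hMd : ∀ z ∈ unitDisk, HasDerivAt M (deriv (deriv φ) z / deriv φ z / m) z := fun z hz =>
    ((hL z hz).const_add _).div_const _
  have hMdiff : DifferentiableOn ℂ M unitDisk := fun z hz =>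
    (hMd z hz).differentiableAt.differentiableWithinAt
  obtain ⟨F, hF⟩ := (hMdiff.cexp).isExactOn_ball (c := 0) (r := 1)
  refine ⟨m, F, M, hm0, fun z hz => (hF z hz).differentiableAt.differentiableWithinAt,
    injOn_of_small_bloch hF hMd fun z hz => ?_, hMdiff, fun z hz => (hF z hz).deriv.symm,
    fun z hz => ?_⟩
  · have h1 := hC z hz
    have h2 := mul_le_mul_of_nonneg_right (le_one_sub_sq hz)
      (norm_nonneg (deriv (deriv φ) z / deriv φ z))
    rw [norm_div _ (m : ℂ), Complex.norm_of_nonneg hm0.le, ← mul_div_assoc, div_le_iff₀ hm0]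
    have := le_abs_self C
    linarith
  · rw [hLe z hz, hM]
    simp only
    rw [mul_div_cancel₀ _ hmC, Complex.exp_add, Complex.exp_log (h0 0 hz0)]

end HarmonicULU

open HarmonicULU in
theorem theorem4p1 (h g : ℂ → ℂ) (hf : HarmonicULU.IsSensePreservingHarmonic h g) :
    -- the nine stability conditions are equivalent
    List.TFAE
      [HarmonicULU.SAULU h g,
        HarmonicULU.SAULC h g,
        HarmonicULU.SBAPSN h g,
        HarmonicULU.SBASN h g,
        HarmonicULU.StablePower h g,
        HarmonicULU.SHULU h g,
        HarmonicULU.SHULC h g,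
        HarmonicULU.SBHPSN h g,
        HarmonicULU.SBHSN h g] ∧
    -- the underlying properties of all the functions `h + ε₁ g` and `h + ε₂ * conj g`, for any
    -- parameters in the closed disk, are equivalent to each other
    (∀ ε₁ ε₂ : ℂ, ‖ε₁‖ ≤ 1 → ‖ε₂‖ ≤ 1 →
      List.TFAE
        [HarmonicULU.ULU (HarmonicULU.anaPerturb h g ε₁),
          HarmonicULU.ULC (HarmonicULU.anaPerturb h g ε₁),
          HarmonicULU.BoundedPSN (HarmonicULU.anaPerturb h g ε₁) 0,
          HarmonicULU.BoundedSN (HarmonicULU.anaPerturb h g ε₁) 0,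
          HarmonicULU.IsPowerOfUnivalent (HarmonicULU.anaPerturb h g ε₁),
          HarmonicULU.ULU (HarmonicULU.harmPerturb h g ε₂),
          HarmonicULU.ULC (HarmonicULU.harmPerturb h g ε₂),
          HarmonicULU.BoundedPSN h (HarmonicULU.coPart g ε₂),
          HarmonicULU.BoundedSN h (HarmonicULU.coPart g ε₂)]) ∧
    -- in particular, for `f = h + conj g` itself
    List.TFAE
      [HarmonicULU.ULU (HarmonicULU.harm h g),
        HarmonicULU.ULC (HarmonicULU.harm h g),
        HarmonicULU.BoundedPSN h g,
        HarmonicULU.BoundedSN h g] := by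
  have hana : ∀ ε : ℂ, ‖ε‖ ≤ 1 → List.TFAE [PreBdd h, ULU (anaPerturb h g ε),
      ULC (anaPerturb h g ε), BoundedPSN (anaPerturb h g ε) 0, BoundedSN (anaPerturb h g ε) 0,
      IsPowerOfUnivalent (anaPerturb h g ε)] := by
    intro ε hε
    have hsp := hf.anaPerturb hε
    have h1 := hsp.tfae_preBdd
    rw [harm_zero] at h1
    have h2 := hf.preBdd_anaPerturb_iff hε
    tfae_have 1 ↔ 2 := h2.symm.trans (h1.out 0 1)
    tfae_have 2 ↔ 3 := h1.out 1 2
    tfae_have 2 ↔ 4 := h1.out 1 3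
    tfae_have 2 ↔ 5 := h1.out 1 4
    tfae_have 1 ↔ 6 := h2.symm.trans ⟨isPowerOfUnivalent_of_preBdd hsp.analytic_h
      fun z hz => hsp.deriv_ne_zero hz, IsPowerOfUnivalent.preBdd⟩
    tfae_finish
  have hharm : ∀ ε : ℂ, ‖ε‖ ≤ 1 → List.TFAE [PreBdd h, ULU (harmPerturb h g ε),
      ULC (harmPerturb h g ε), BoundedPSN h (coPart g ε), BoundedSN h (coPart g ε)] :=
    fun ε hε => (hf.coPart hε).tfae_preBdd
  have stable : ∀ p : ℂ → Prop, (∀ ε : ℂ, ‖ε‖ ≤ 1 → (PreBdd h ↔ p ε)) → Stable p :=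
    fun p hp ε₁ ε₂ h₁ h₂ _ => (hp ε₁ h₁).symm.trans (hp ε₂ h₂)
  refine ⟨?_, fun ε₁ ε₂ h₁ h₂ => ?_, ?_⟩
  -- The nine stability conditions are equivalent because each of them holds: the properties
  -- concerned are all equivalent to `PreBdd h`, which does not involve `ε`.
  · refine List.tfae_of_forall True _ fun p hp => iff_true_intro ?_
    simp only [List.mem_cons, List.not_mem_nil, or_false] at hp
    rcases hp with rfl | rfl | rfl | rfl | rfl | rfl | rfl | rfl | rfl
    · exact stable _ fun ε hε => (hana ε hε).out 0 1
    · exact stable _ fun ε hε => (hana ε hε).out 0 2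
    · exact stable _ fun ε hε => (hana ε hε).out 0 3
    · exact stable _ fun ε hε => (hana ε hε).out 0 4
    · exact stable _ fun ε hε => (hana ε hε).out 0 5
    · exact stable _ fun ε hε => (hharm ε hε).out 0 1
    · exact stable _ fun ε hε => (hharm ε hε).out 0 2
    · exact stable _ fun ε hε => (hharm ε hε).out 0 3
    · exact stable _ fun ε hε => (hharm ε hε).out 0 4
  · have ha := hana ε₁ h₁
    have hh := hharm ε₂ h₂
    refine List.tfae_of_forall (PreBdd h) _ fun p hp => ?_
    simp only [List.mem_cons, List.not_mem_nil, or_false] at hp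
    rcases hp with rfl | rfl | rfl | rfl | rfl | rfl | rfl | rfl | rfl
    · exact ha.out 1 0
    · exact ha.out 2 0
    · exact ha.out 3 0
    · exact ha.out 4 0
    · exact ha.out 5 0
    · exact hh.out 1 0
    · exact hh.out 2 0
    · exact hh.out 3 0
    · exact hh.out 4 0
  · have ht := hf.tfae_preBdd
    tfae_have 1 ↔ 2 := ht.out 1 2
    tfae_have 1 ↔ 3 := ht.out 1 3
    tfae_have 1 ↔ 4 := ht.out 1 4
    tfae_finish
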